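/- Let $v(x)=(-\sin x_1\sin x_2,\,-\cos x_1\cos x_2,\,\sqrt2\,\sin x_1\cos x_2)$ on $\mathbb R^3$ (the "AB flow") and $\psi(x)=\sin x_1\cos x_2$. Then $v$ is a $C^1$ steady solution of the incompressible Euler equations, i.e. $\nabla\cdot v=0$ and $(v\cdot\nabla)v=-\nabla p$ for some $C^1$ function $p$, and it is a Beltrami field: $\nabla\times v=\sqrt2\,v$. There is a unique Lagrangian map, that is, a map $(a,t)\mapsto x(a,t)\in\mathbb R^3$ ($a\in\mathbb R^3$, $t\in\mathbb R$) with $\dot x=v(x)$ and $x(a,0)=a$, and it has the following properties. 1. (Integration by an elliptic integral.) For all $a$ and $t$: $\psi(x(a,t))=\psi(a)=:\psi$, $x_3(a,t)=a_3+\sqrt2\,\psi\,t$, and $w(t)=\sin^2x_1(a,t)$ satisfies $$\dot w=-2\,\operatorname{sgn}(\cos x_1\sin x_2)\sqrt{w(1-w)(w-\psi^2)}.$$ If $\sin a_1\ne0$ and $\varepsilon\cos x_1\sin x_2>0$ on a time interval $(t_0,t_1)$, where $\varepsilon\in\{1,-1\}$, then $$\int_{w(t_0)}^{w(t_1)}\frac{dw}{\sqrt{w(1-w)(w-\psi^2)}}=-2\varepsilon(t_1-t_0),$$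 where the integral converges absolutely. If $\sin a_1=0$ (so that $w\equiv0$), then $x_1(a,t)=a_1$ and $$\sin x_2(a,t)=\frac{\sin a_2-\tanh(t\cos a_1)}{1-\sin a_2\tanh(t\cos a_1)}.$$ 2. (Nearest complex-time singularity.) Call $\tau\in\mathbb C$ a complex-time singularity of the particle $a$ if the germ of $t\mapsto x(a,t)$ at $t=0$ continues analytically to a neighbourhood of the half-open segment $[0,\tau)\subset\mathbb C$, but not to a neighbourhood of the closed segment $[0,\tau]$. Put $$t_\star=\frac{i}{2}\int_1^\infty\frac{dw}{w\sqrt{w-1}}=\frac{i\pi}{2}$$ (an absolutely convergent integral). Then $t_\star$ is a complex-time singularity of every particle $a$ with $\psi(a)=0$ and $\sin^2a_1=1$. Every complex-time singularity $\tau$ of every particle satisfies $|\tau|\ge\pi/2$, with equality only if $\tau=\pm t_\star$. 3. (Radius of convergence.) Let $\xi^{(s)}(a)=\frac1{s!}\,\partial_t^s\big(x(a,t)-a\big)\big|_{t=0}$ for $s\ge0$. For every $a$ and every real $t$ with $|t|<\pi/2$ the series $\sum_s\xi^{(s)}(a)t^s$ converges to $x(a,t)-a$. The radius of convergence of the time-Taylor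 series of the Lagrangian map is exactly $\pi/2$, both pointwise (the infimum over all particles $a$ of the radius of convergence of $\sum_s\xi^{(s)}(a)t^s$ equals $\pi/2$, and it is attained) and uniformly (the supremum of the $r\ge0$ for which $\sup_{s,a}|\xi^{(s)}(a)|\,r^s<\infty$ equals $\pi/2$). -/

import Mathlib

open Filter Topology MeasureTheory
open scoped NNReal ENNReal Nat

noncomputable section

/-- Physical space `ℝ³`; the coordinates `x₁, x₂, x₃` are `x 0, x 1, x 2`. -/
abbrev E3 : Type := EuclideanSpace ℝ (Fin 3)

/-- The `i`-th partial derivative of the `j`-th component of a vector field. -/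
def partialD (i : Fin 3) (v : E3 → E3) (j : Fin 3) (x : E3) : ℝ :=
  fderiv ℝ v x (EuclideanSpace.single i 1) j

def divergence (v : E3 → E3) (x : E3) : ℝ := ∑ i, partialD i v i x

def curl (v : E3 → E3) (x : E3) : E3 :=
  !₂[partialD 1 v 2 x - partialD 2 v 1 x,
     partialD 2 v 0 x - partialD 0 v 2 x,
     partialD 0 v 1 x - partialD 1 v 0 x]

/-- A time-independent solution `(v, p)` of the incompressible Euler equations
`(v · ∇) v = -∇p`, `∇ · v = 0`. -/
def IsSteadyEuler (v : E3 → E3) : Prop :=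
  ContDiff ℝ 1 v ∧ (∀ x, divergence v x = 0) ∧
    ∃ p : E3 → ℝ, ContDiff ℝ 1 p ∧ ∀ x, fderiv ℝ v x (v x) = -gradient p x

/-- The AB flow. -/
def abFlow (x : E3) : E3 :=
  !₂[-(Real.sin (x 0) * Real.sin (x 1)),
     -(Real.cos (x 0) * Real.cos (x 1)),
     √2 * Real.sin (x 0) * Real.cos (x 1)]

/-- The stream function of the horizontal part of the AB flow. -/
def abStream (x : E3) : ℝ := Real.sin (x 0) * Real.cos (x 1)

/-- `X a t` is the position at time `t ∈ ℝ` of the fluid particle that starts at `a`, in the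
steady velocity field `v`. -/
def IsLagrangianMap (v : E3 → E3) (X : E3 → ℝ → E3) : Prop :=
  ∀ a, X a 0 = a ∧ ∀ t, HasDerivAt (X a) (v (X a t)) t

/-- The `s`-th time-Taylor coefficient at `t = 0` of the displacement `X a t - a`. -/
def taylorCoeff (X : E3 → ℝ → E3) (a : E3) (s : ℕ) : E3 :=
  ((s ! : ℝ)⁻¹) • iteratedDeriv s (fun t => X a t - a) 0

/-- The time-Taylor series of the displacement of the particle `a`, as a power series. -/
def taylorSeries (X : E3 → ℝ → E3) (a : E3) : FormalMultilinearSeries ℝ ℝ E3 :=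
  fun s => ContinuousMultilinearMap.mkPiRing ℝ (Fin s) (taylorCoeff X a s)

/-- The radius of convergence of the time-Taylor series of the Lagrangian map, pointwise in the
particle: the series converges at every particle for `|t|` below it. -/
def lagrangianRadius (X : E3 → ℝ → E3) : ℝ≥0∞ := ⨅ a, (taylorSeries X a).radius

/-- The radius of convergence of the time-Taylor series of the Lagrangian map for the supremum
norm over all particles. -/
def uniformLagrangianRadius (X : E3 → ℝ → E3) : ℝ≥0∞ :=
  ⨆ (r : ℝ≥0) (_ : ∃ C : ℝ, ∀ (s : ℕ) (a : E3), ‖taylorCoeff X a s‖ * (r : ℝ) ^ s ≤ C), (r : ℝ≥0∞)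

/-- The germ at `t = 0` of the real curve `x` extends to a complex-analytic function on a
neighbourhood of the set `A ⊆ ℂ`. -/
def ContinuesTo (x : ℝ → E3) (A : Set ℂ) : Prop :=
  ∃ (U : Set ℂ) (f : ℂ → EuclideanSpace ℂ (Fin 3)), IsOpen U ∧ A ⊆ U ∧ AnalyticOnNhd ℂ f U ∧
    ∀ᶠ t : ℝ in 𝓝 0, ∀ i, f (t : ℂ) i = ((x t i : ℝ) : ℂ)

/-- `τ` is a complex-time singularity of `x`: the curve continues analytically along the straight
path from `0` to `τ` up to, but not through, the end point `τ`. -/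
def IsComplexTimeSingularity (x : ℝ → E3) (τ : ℂ) : Prop :=
  ContinuesTo x ((fun s : ℝ => (s : ℂ) * τ) '' Set.Ico 0 1) ∧
    ¬ ContinuesTo x ((fun s : ℝ => (s : ℂ) * τ) '' Set.Icc 0 1)

end

/-! In the variables α = x₁ + x₂ and β = x₁ - x₂ the horizontal motion is α' = -cos β, β' = cos α
(`PlanarAB.cosineSystem`). For complex time, |cos w| ≤ cosh (Im w), so along a ray from 0 the larger
of |Im α|, |Im β| is controlled by the solution arsinh (tan s) of Y' = cosh Y, Y(0) = 0, which blows
up only at s = π/2 (`CosineSystem.abs_im_extension_le`).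

This a priori bound becomes a continuation as follows. The sines and cosines of α, β solve a
quadratic system; a bound D for them on a disc gives n-th derivatives at most n! D^(n+1), and these
enlarge the disc by 1/(2D) (`norm_iteratedDeriv_zero_mul_pow_le`,
`CosineSystem.exists_larger_extension`). On the real line D = 1 gives a starting disc of radius 1,
and since the gain depends on the bound only, finitely many steps reach any radius r < π/2. The
system is autonomous, so such discs exist around every real time, and they glue to the strip |Im t|
< π/2 (`exists_extension_strip`). Hence every singularity has |Im τ| ≥ π/2, and all constants are
uniform in the particle.

Sharpness: if ψ = 0 and sin² a₁ = 1, then x₂ is constant and x₁' = ±1/cosh t, which has a pole at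
iπ/2 (`exists_hasDerivAt_div_cosh`, `not_continuesTo_half_pi`).

The elliptic integral rests on w(1-w)(w-ψ²) being a perfect square along a trajectory
(`sqrt_cubic_eq`), which makes the substitution w = sin² x₁ turn the integrand into the constant 2.
-/

/-! ### Factorial derivative bounds and Taylor series. -/

/-- A product rule estimate: the bounds `k! D ^ (k + 1)` on derivatives are reproduced by
products, with a shift of the order. -/
lemma norm_iteratedDeriv_mul_le_factorial {𝕜 : Type*} [RCLike 𝕜] {f g : 𝕜 → 𝕜} {x : 𝕜} {D : ℝ}
    {n : ℕ} (hf : ContDiffAt 𝕜 n f x) (hg : ContDiffAt 𝕜 n g x)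
    (hfD : ∀ k ≤ n, ‖iteratedDeriv k f x‖ ≤ k ! * D ^ (k + 1))
    (hgD : ∀ k ≤ n, ‖iteratedDeriv k g x‖ ≤ k ! * D ^ (k + 1)) :
    ‖iteratedDeriv n (fun y => f y * g y) x‖ ≤ (n + 1)! * D ^ (n + 2) := by
  rw [iteratedDeriv_fun_mul hf hg]
  -- In each Leibniz term the factorials i! and (n - i)! absorb the binomial coefficient into n!;
  -- the n + 1 equal bounds then make (n + 1)!, the bound needed for the next derivative of a
  -- quadratic system.
  calc _ ≤ ∑ i ∈ Finset.range (n + 1), (n ! : ℝ) * D ^ (n + 2) := by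
        refine norm_sum_le_of_le _ fun i hi => ?_
        have hin : i ≤ n := by simpa [Nat.lt_succ_iff] using hi
        rw [norm_mul, norm_mul]
        have h1 := hfD i hin
        have h2 := hgD (n - i) (Nat.sub_le _ _)
        have h3 : ‖((n.choose i : ℕ) : 𝕜)‖ = (n.choose i : ℝ) := by simp
        rw [h3, mul_assoc]
        calc _ ≤ (n.choose i : ℝ) * ((i ! * D ^ (i + 1)) * ((n - i)! * D ^ (n - i + 1))) := by
              gcongr
              exact (norm_nonneg _).trans h1
          _ = ((n.choose i * i ! * (n - i)! : ℕ) : ℝ) * (D ^ (i + 1) * D ^ (n - i + 1)) := by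
              push_cast; ring
          _ = (n ! : ℝ) * D ^ (n + 2) := by
              rw [Nat.choose_mul_factorial_mul_factorial hin, ← pow_add]
              congr 2; omega
    _ = (n + 1)! * D ^ (n + 2) := by
        simp [Nat.factorial_succ]; ring

/-- Solutions of a quadratic system `uᵢ' = cᵢ u_{p i} u_{q i}` that are bounded by `D` on an open
set have their `n`-th derivatives bounded by `n! D ^ (n + 1)` there. -/
lemma norm_iteratedDeriv_le_of_quadratic_system {𝕜 ι : Type*} [RCLike 𝕜] {U : Set 𝕜}
    (hU : IsOpen U) {u : ι → 𝕜 → 𝕜} {c : ι → 𝕜} {p q : ι → ι} {D : ℝ}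
    (hc : ∀ i, ‖c i‖ ≤ 1)
    (hu : ∀ i, ∀ x ∈ U, HasDerivAt (u i) (c i * (u (p i) x * u (q i) x)) x)
    (hs : ∀ i, ∀ x ∈ U, ∀ n : ℕ, ContDiffAt 𝕜 n (u i) x)
    (hD : ∀ i, ∀ x ∈ U, ‖u i x‖ ≤ D) (n : ℕ) :
    ∀ i, ∀ x ∈ U, ‖iteratedDeriv n (u i) x‖ ≤ n ! * D ^ (n + 1) := by
  induction n using Nat.strong_induction_on with
  | _ n ih =>
    intro i x hx
    cases n with
    | zero => simpa using hD i x hx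
    | succ n =>
      have he : deriv (u i) =ᶠ[𝓝 x] fun y => c i * (u (p i) y * u (q i) y) := by
        filter_upwards [hU.mem_nhds hx] with y hy using (hu i y hy).deriv
      rw [iteratedDeriv_succ', he.iteratedDeriv_eq,
        iteratedDeriv_const_mul_field, norm_mul]
      have h := norm_iteratedDeriv_mul_le_factorial (D := D) (hs (p i) x hx n) (hs (q i) x hx n)
        (fun k hk => ih k (by omega) _ x hx) (fun k hk => ih k (by omega) _ x hx)
      calc _ ≤ 1 * ‖iteratedDeriv n (fun y => u (p i) y * u (q i) y) x‖ := by
            gcongr; exact hc i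
        _ ≤ _ := by rw [one_mul]; exact h

/-- If the derivatives of `f` grow like `n! D ^ (n + 1)` uniformly on a disc of radius `ρ`, the
Taylor coefficients at the centre decay as on a disc of radius `ρ + 1 / (2 D)`. -/
lemma norm_iteratedDeriv_zero_mul_pow_le {f : ℂ → ℂ} {ρ D : ℝ} (hρ : 0 < ρ) (hD : 0 < D)
    (hf : DifferentiableOn ℂ f (Metric.ball 0 ρ))
    (hb : ∀ n : ℕ, ∀ z ∈ Metric.ball (0 : ℂ) ρ, ‖iteratedDeriv n f z‖ ≤ n ! * D ^ (n + 1))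
    (N : ℕ) : ‖iteratedDeriv N f 0‖ / N ! * (ρ + 1 / (2 * D)) ^ N ≤ 2 * D := by
  have key : ∀ r ∈ Set.Ioo 0 ρ,
      ‖iteratedDeriv N f 0‖ / N ! * (r + 1 / (2 * D)) ^ N ≤ 2 * D := by
    rintro r ⟨hr0, hrρ⟩
    have hNf : (0 : ℝ) < N ! := by positivity
    -- One term of the binomial expansion of (r + 1/(2D))^N. Cauchy's estimate of order N - n for
    -- the n-th derivative gives |f^(N)(0)| r^(N-n) ≤ (N-n)! n! D^(n+1); the 2 in 1/(2D) leaves the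
    -- summable factor 2^(-n).
    have term : ∀ n ≤ N, ‖iteratedDeriv N f 0‖ / N ! *
        (r ^ (N - n) * (1 / (2 * D)) ^ n * N.choose n) ≤ D * (1 / 2) ^ n := by
      intro n hn
      have hbl : Metric.closedBall (0 : ℂ) r ⊆ Metric.ball 0 ρ :=
        Metric.closedBall_subset_ball hrρ
      have han : AnalyticOnNhd ℂ f (Metric.ball 0 ρ) := hf.analyticOnNhd Metric.isOpen_ball
      have hd : DiffContOnCl ℂ (iteratedDeriv n f) (Metric.ball 0 r) := by
        refine DifferentiableOn.diffContOnCl ?_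
        rw [closure_ball _ hr0.ne']
        rw [iteratedDeriv_eq_iterate]
        exact ((han.iterated_deriv n).differentiableOn).mono hbl
      have h1 := Complex.norm_iteratedDeriv_le_of_forall_mem_sphere_norm_le (N - n) hr0 hd
        (C := n ! * D ^ (n + 1))
        (fun z hz => hb n z (hbl (Metric.sphere_subset_closedBall hz)))
      have h2 : iteratedDeriv (N - n) (iteratedDeriv n f) 0 = iteratedDeriv N f 0 := by
        rw [iteratedDeriv_eq_iterate, iteratedDeriv_eq_iterate, iteratedDeriv_eq_iterate,
          ← Function.iterate_add_apply, Nat.sub_add_cancel hn]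
      rw [h2, le_div_iff₀ (by positivity)] at h1
      have h3 : (N.choose n : ℝ) * n ! * (N - n)! = N ! := by
        exact_mod_cast Nat.choose_mul_factorial_mul_factorial hn
      calc ‖iteratedDeriv N f 0‖ / N ! * (r ^ (N - n) * (1 / (2 * D)) ^ n * N.choose n)
          = (‖iteratedDeriv N f 0‖ * r ^ (N - n)) * ((1 / (2 * D)) ^ n * N.choose n / N !) := by
            ring
        _ ≤ ((N - n)! * (n ! * D ^ (n + 1))) * ((1 / (2 * D)) ^ n * N.choose n / N !) := by
            gcongr
        _ = (N.choose n * n ! * (N - n)!) * D * (D ^ n * (1 / (2 * D)) ^ n) / N ! := by ring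
        _ = D * (1 / 2) ^ n := by
            rw [h3, ← mul_pow]
            have : D * (1 / (2 * D)) = 1 / 2 := by field_simp
            rw [this]; field_simp
    rw [add_comm r, add_pow, Finset.mul_sum]
    calc _ ≤ ∑ n ∈ Finset.range (N + 1), D * (1 / 2 : ℝ) ^ n := by
          refine Finset.sum_le_sum fun n hn => ?_
          have := term n (by simpa [Nat.lt_succ_iff] using hn)
          rwa [mul_comm (r ^ (N - n))] at this
      _ ≤ D * 2 := by
          rw [← Finset.mul_sum]
          gcongr
          exact sum_geometric_two_le _
      _ = 2 * D := mul_comm _ _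
  -- Cauchy's estimate needs a closed disc inside the domain, hence r < ρ so far; the bound is
  -- independent of r and passes to the limit r → ρ.
  have hcont : Continuous fun r : ℝ => ‖iteratedDeriv N f 0‖ / N ! * (r + 1 / (2 * D)) ^ N := by
    fun_prop
  refine le_of_tendsto (hcont.continuousWithinAt (s := Set.Iio ρ) (x := ρ)) ?_
  filter_upwards [Ioo_mem_nhdsLT hρ] with r hr using key r hr

/-- Power series whose coefficients are bounded by a geometric sequence. -/
lemma differentiableOn_tsum_pow {c : ℕ → ℂ} {R C : ℝ} (hc : ∀ n, ‖c n‖ * R ^ n ≤ C) :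
    DifferentiableOn ℂ (fun z => ∑' n, z ^ n * c n) (Metric.ball 0 R) ∧
      ∀ z ∈ Metric.ball (0 : ℂ) R, HasSum (fun n => z ^ n * c n) (∑' n, z ^ n * c n) := by
  have main : ∀ r, 0 < r → r < R → ∃ v : ℕ → ℝ, Summable v ∧
      ∀ n, ∀ z ∈ Metric.ball (0 : ℂ) r, ‖z ^ n * c n‖ ≤ v n := by
    intro r hr hrR
    have hR : 0 < R := hr.trans hrR
    refine ⟨fun n => C * (r / R) ^ n, (summable_geometric_of_lt_one (by positivity)
      ((div_lt_one hR).2 hrR)).mul_left C, fun n z hz => ?_⟩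
    have hz' : ‖z‖ ≤ r := by simpa using (le_of_lt (by simpa using hz : ‖z‖ < r))
    calc ‖z ^ n * c n‖ = ‖z‖ ^ n * ‖c n‖ := by simp
      _ ≤ r ^ n * ‖c n‖ := by gcongr
      _ = (‖c n‖ * R ^ n) * (r / R) ^ n := by
          rw [div_pow]; field_simp
      _ ≤ C * (r / R) ^ n := by gcongr; exact hc n
  have between : ∀ z ∈ Metric.ball (0 : ℂ) R, ∃ r, 0 < r ∧ r < R ∧ z ∈ Metric.ball (0 : ℂ) r := by
    intro z hz
    have hz' : ‖z‖ < R := by simpa using hz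
    obtain ⟨r, h1, h2⟩ := exists_between hz'
    exact ⟨r, (norm_nonneg z).trans_lt h1, h2, by simpa using h1⟩
  constructor
  · intro z hz
    obtain ⟨r, hr, hrR, hzr⟩ := between z hz
    obtain ⟨v, hv, hb⟩ := main r hr hrR
    exact ((Complex.differentiableOn_tsum_of_summable_norm hv
      (fun n => by fun_prop) Metric.isOpen_ball hb).differentiableAt
        (Metric.isOpen_ball.mem_nhds hzr)).differentiableWithinAt
  · intro z hz
    obtain ⟨r, hr, hrR, hzr⟩ := between z hz
    obtain ⟨v, hv, hb⟩ := main r hr hrR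
    exact (Summable.of_norm_bounded hv (fun n => hb n z hzr)).hasSum

/-- A smooth real function with derivatives `O(n!)` is the restriction of a holomorphic function
on the unit disc. -/
lemma exists_holomorphic_extension_of_iteratedDeriv_le {f : ℝ → ℝ} {C : ℝ}
    (hf : ∀ n : ℕ, ContDiff ℝ n f)
    (hC : ∀ (n : ℕ) (t : ℝ), |iteratedDeriv (n + 1) f t| ≤ (n + 1)! * C) :
    ∃ F : ℂ → ℂ, DifferentiableOn ℂ F (Metric.ball 0 1) ∧
      ∀ t : ℝ, |t| < 1 → F t = (f t : ℂ) := by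
  have hC0 : 0 ≤ C := by
    have := (abs_nonneg _).trans (hC 0 0)
    simpa using this
  have hc : ∀ n, ‖((iteratedDeriv n f 0 / n ! : ℝ) : ℂ)‖ * (1 : ℝ) ^ n ≤ |f 0| + C := by
    intro n
    rw [one_pow, mul_one, Complex.norm_real, Real.norm_eq_abs, abs_div, Nat.abs_cast]
    cases n with
    | zero => simpa using hC0
    | succ n =>
      have h := hC n 0
      have : |iteratedDeriv (n + 1) f 0| / (n + 1)! ≤ C := by
        rw [div_le_iff₀ (by positivity), mul_comm]; exact h
      linarith [abs_nonneg (f 0)]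
  obtain ⟨h1, h2⟩ := differentiableOn_tsum_pow hc
  refine ⟨_, h1, fun t ht => ?_⟩
  have hs := (h2 t (by simpa using ht)).tendsto_sum_nat
  refine tendsto_nhds_unique hs ?_
  have hreal : Tendsto (fun n => ∑ i ∈ Finset.range n, t ^ i * (iteratedDeriv i f 0 / i !)) atTop
      (𝓝 (f t)) := by
    -- The Lagrange remainder needs a nondegenerate interval. For t ≠ 0 it is at most C |t|^(n+1),
    -- because the derivative bound holds at every real point and not only at 0.
    rcases eq_or_ne (0 : ℝ) t with rfl | hne
    · refine tendsto_const_nhds.congr' ?_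
      filter_upwards [eventually_gt_atTop 0] with n hn
      obtain ⟨m, rfl⟩ := Nat.exists_eq_succ_of_ne_zero hn.ne'
      rw [Finset.sum_range_succ']
      simp
    rw [← tendsto_add_atTop_iff_nat 1]
    rw [tendsto_iff_norm_sub_tendsto_zero]
    refine squeeze_zero (fun _ => norm_nonneg _) (g := fun n => C * |t| ^ (n + 1)) (fun n => ?_) ?_
    · obtain ⟨x', -, hx'⟩ := taylor_mean_remainder_lagrange_iteratedDeriv (n := n) hne
        ((hf (n + 1)).contDiffOn)
      have hT : taylorWithinEval f n (Set.uIcc 0 t) 0 t =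
          ∑ i ∈ Finset.range (n + 1), t ^ i * (iteratedDeriv i f 0 / i !) := by
        rw [taylor_within_apply]
        refine Finset.sum_congr rfl fun i _ => ?_
        rw [iteratedDerivWithin_eq_iteratedDeriv (uniqueDiffOn_uIcc hne) (hf i).contDiffAt
          Set.left_mem_uIcc]
        simp; ring
      rw [hT] at hx'
      rw [← norm_neg, neg_sub, hx', sub_zero, Real.norm_eq_abs, abs_div, abs_mul, abs_pow,
        Nat.abs_cast, div_le_iff₀ (by positivity)]
      calc _ ≤ ((n + 1)! * C) * |t| ^ (n + 1) := by gcongr; exact hC n x'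
        _ = _ := by ring
    · have := (tendsto_pow_atTop_nhds_zero_of_lt_one (abs_nonneg t) ht).const_mul C
      rw [mul_zero] at this
      exact (tendsto_add_atTop_iff_nat 1).2 this
  have := (Complex.continuous_ofReal.tendsto _).comp hreal
  refine this.congr fun n => ?_
  simp

/-! ### Estimates and identity principles for complexified real functions. -/

/-- The sines and cosines `sa, ca, sb, cb` of a solution of `α' = -cos β`, `β' = cos α`. -/
lemma norm_iteratedDeriv_le_of_cosineSystem {𝕜 : Type*} [RCLike 𝕜] {U : Set 𝕜} (hU : IsOpen U)
    {sa ca sb cb : 𝕜 → 𝕜} {D : ℝ}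
    (hsa : ∀ x ∈ U, HasDerivAt sa (-(ca x * cb x)) x)
    (hca : ∀ x ∈ U, HasDerivAt ca (sa x * cb x) x)
    (hsb : ∀ x ∈ U, HasDerivAt sb (cb x * ca x) x)
    (hcb : ∀ x ∈ U, HasDerivAt cb (-(sb x * ca x)) x)
    (hs : ∀ x ∈ U, ∀ n : ℕ, ContDiffAt 𝕜 n sa x ∧ ContDiffAt 𝕜 n ca x ∧ ContDiffAt 𝕜 n sb x ∧
      ContDiffAt 𝕜 n cb x)
    (hD : ∀ x ∈ U, ‖sa x‖ ≤ D ∧ ‖ca x‖ ≤ D ∧ ‖sb x‖ ≤ D ∧ ‖cb x‖ ≤ D) (n : ℕ) :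
    ∀ x ∈ U, ‖iteratedDeriv n ca x‖ ≤ n ! * D ^ (n + 1) ∧
      ‖iteratedDeriv n cb x‖ ≤ n ! * D ^ (n + 1) := by
  -- Indices 0, 1, 2, 3 stand for `sa`, `ca`, `sb`, `cb`; `c`, `p`, `q` list the sign and the two
  -- factors of each right-hand side.
  have h := norm_iteratedDeriv_le_of_quadratic_system (ι := Fin 4) hU (u := ![sa, ca, sb, cb])
    (c := ![-1, 1, 1, -1]) (p := ![1, 0, 3, 2]) (q := ![3, 3, 1, 1]) (D := D)
    (fun i => by fin_cases i <;> simp)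
    (fun i x hx => by
      fin_cases i
      · simpa using hsa x hx
      · simpa using hca x hx
      · simpa using hsb x hx
      · simpa using hcb x hx)
    (fun i x hx n => by
      obtain ⟨h1, h2, h3, h4⟩ := hs x hx n
      fin_cases i <;> assumption)
    (fun i x hx => by
      obtain ⟨h1, h2, h3, h4⟩ := hD x hx
      fin_cases i <;> assumption) n
  exact fun x hx => ⟨h 1 x hx, h 3 x hx⟩

lemma Complex.norm_cos_le_cosh_im (w : ℂ) : ‖Complex.cos w‖ ≤ Real.cosh w.im := by
  rw [Complex.cos, Real.cosh_eq, norm_div]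
  refine (div_le_div_of_nonneg_right (norm_add_le _ _) (norm_nonneg _)).trans ?_
  simp [Complex.norm_exp, add_comm]

lemma Complex.norm_sin_le_cosh_im (w : ℂ) : ‖Complex.sin w‖ ≤ Real.cosh w.im := by
  rw [Complex.sin, Real.cosh_eq, norm_div, norm_mul]
  simp only [Complex.norm_I, mul_one]
  refine (div_le_div_of_nonneg_right (norm_sub_le _ _) (norm_nonneg _)).trans ?_
  simp [Complex.norm_exp]

/-- Identity theorem for holomorphic functions that agree on a real neighbourhood. -/
lemma eqOn_of_real_eventuallyEq {F G : ℂ → ℂ} {V : Set ℂ} (hF : AnalyticOnNhd ℂ F V)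
    (hG : AnalyticOnNhd ℂ G V) (hV : IsPreconnected V) {x : ℝ} (hx : (x : ℂ) ∈ V)
    (h : ∀ᶠ t : ℝ in 𝓝 x, F t = G t) : Set.EqOn F G V := by
  refine hF.eqOn_of_preconnected_of_frequently_eq hG hV hx ?_
  have ht : Tendsto (fun t : ℝ => (t : ℂ)) (𝓝[≠] x) (𝓝[≠] (x : ℂ)) := by
    refine tendsto_nhdsWithin_of_tendsto_nhds_of_eventually_within _
      (Complex.continuous_ofReal.continuousAt.tendsto.mono_left nhdsWithin_le_nhds) ?_
    filter_upwards [self_mem_nhdsWithin] with t ht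
    simpa using ht
  exact ht.frequently (h.filter_mono nhdsWithin_le_nhds).frequently

/-- If a holomorphic function is real on the real axis near `x`, so is its derivative. -/
lemma HasDerivAt.real_of_eventuallyEq_ofReal {F : ℂ → ℂ} {f : ℝ → ℝ} {F' : ℂ} {x : ℝ}
    (hF : HasDerivAt F F' x) (h : ∀ᶠ t : ℝ in 𝓝 x, F t = f t) :
    HasDerivAt f F'.re x ∧ F' = (F'.re : ℂ) := by
  have h1 : HasDerivAt f F'.re x := by
    refine hF.real_of_complex.congr_of_eventuallyEq ?_
    filter_upwards [h] with t ht
    simp [ht]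
  refine ⟨h1, ?_⟩
  have h2 : HasDerivAt (fun t : ℝ => (f t : ℂ)) F' x :=
    hF.comp_ofReal.congr_of_eventuallyEq (by filter_upwards [h] with t ht using ht.symm)
  exact h2.unique h1.ofReal_comp

/-! ### The cosine system and its a priori bound in complex time. -/

/-- The system satisfied by the sum and the difference of the horizontal coordinates of a particle
in the AB flow. -/
structure CosineSystem (α β : ℝ → ℝ) : Prop where
  left : ∀ t, HasDerivAt α (-Real.cos (β t)) t
  right : ∀ t, HasDerivAt β (Real.cos (α t)) t

/-- `A` is holomorphic on the disc of radius `ρ` and extends the germ of `α` at `0`. -/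
def ExtendsToBall (α : ℝ → ℝ) (A : ℂ → ℂ) (ρ : ℝ) : Prop :=
  DifferentiableOn ℂ A (Metric.ball 0 ρ) ∧ ∀ᶠ t : ℝ in 𝓝 0, A t = α t

lemma ExtendsToBall.mono {α : ℝ → ℝ} {A : ℂ → ℂ} {ρ ρ' : ℝ} (h : ExtendsToBall α A ρ)
    (hρ : ρ' ≤ ρ) : ExtendsToBall α A ρ' :=
  ⟨h.1.mono (Metric.ball_subset_ball hρ), h.2⟩

namespace CosineSystem

variable {α β : ℝ → ℝ}

lemma translate (h : CosineSystem α β) (t₀ : ℝ) :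
    CosineSystem (fun t => α (t₀ + t)) (fun t => β (t₀ + t)) :=
  ⟨fun t => (h.left (t₀ + t)).comp_const_add t₀ t,
    fun t => (h.right (t₀ + t)).comp_const_add t₀ t⟩

lemma contDiff (h : CosineSystem α β) (n : ℕ) : ContDiff ℝ n α ∧ ContDiff ℝ n β := by
  have hda : deriv α = fun t => -Real.cos (β t) := funext fun t => (h.left t).deriv
  have hdb : deriv β = fun t => Real.cos (α t) := funext fun t => (h.right t).deriv
  have h1 : Differentiable ℝ α := fun t => (h.left t).differentiableAt
  have h2 : Differentiable ℝ β := fun t => (h.right t).differentiableAt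
  induction n with
  | zero => exact ⟨contDiff_zero.2 h1.continuous, contDiff_zero.2 h2.continuous⟩
  | succ n ih =>
    push_cast
    refine ⟨contDiff_succ_iff_deriv.2 ⟨h1, by simp, ?_⟩, contDiff_succ_iff_deriv.2 ⟨h2, by simp, ?_⟩⟩
    · rw [hda]; exact ih.2.cos.neg
    · rw [hdb]; exact ih.1.cos

/-- Real sines and cosines are bounded by D = 1, and the derivatives of α, β are cosines. Order 0 is
excluded because α and β themselves need not be bounded. -/
lemma abs_iteratedDeriv_succ_le (h : CosineSystem α β) (n : ℕ) (t : ℝ) :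
    |iteratedDeriv (n + 1) α t| ≤ (n + 1)! * 1 ∧ |iteratedDeriv (n + 1) β t| ≤ (n + 1)! * 1 := by
  have hda : deriv α = fun t => -Real.cos (β t) := funext fun t => (h.left t).deriv
  have hdb : deriv β = fun t => Real.cos (α t) := funext fun t => (h.right t).deriv
  obtain ⟨h1, h2⟩ := norm_iteratedDeriv_le_of_cosineSystem (𝕜 := ℝ) isOpen_univ
    (sa := fun t => Real.sin (α t)) (ca := fun t => Real.cos (α t))
    (sb := fun t => Real.sin (β t)) (cb := fun t => Real.cos (β t)) (D := 1)
    (fun x _ => by simpa using (h.left x).sin)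
    (fun x _ => by simpa using (h.left x).cos)
    (fun x _ => by convert (h.right x).sin using 1)
    (fun x _ => by simpa using (h.right x).cos)
    (fun x _ n => by
      obtain ⟨h1, h2⟩ := h.contDiff n
      exact ⟨h1.sin.contDiffAt, h1.cos.contDiffAt, h2.sin.contDiffAt, h2.cos.contDiffAt⟩)
    (fun x _ => ⟨Real.abs_sin_le_one _, Real.abs_cos_le_one _, Real.abs_sin_le_one _,
      Real.abs_cos_le_one _⟩) n t (Set.mem_univ t)
  have hle : (n ! : ℝ) ≤ (n + 1)! := by exact_mod_cast Nat.factorial_le (Nat.le_succ n)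
  rw [Real.norm_eq_abs, one_pow, mul_one] at h1 h2
  rw [iteratedDeriv_succ', iteratedDeriv_succ', hda, hdb, iteratedDeriv_fun_neg, abs_neg, mul_one]
  exact ⟨h2.trans hle, h1.trans hle⟩

lemma exists_extendsToBall_one (h : CosineSystem α β) :
    ∃ A B, ExtendsToBall α A 1 ∧ ExtendsToBall β B 1 := by
  obtain ⟨A, hA, hA'⟩ := exists_holomorphic_extension_of_iteratedDeriv_le
    (fun n => (h.contDiff n).1) (fun n t => (h.abs_iteratedDeriv_succ_le n t).1)
  obtain ⟨B, hB, hB'⟩ := exists_holomorphic_extension_of_iteratedDeriv_le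
    (fun n => (h.contDiff n).2) (fun n t => (h.abs_iteratedDeriv_succ_le n t).2)
  have he : ∀ᶠ t : ℝ in 𝓝 0, |t| < 1 := by
    filter_upwards [Metric.ball_mem_nhds (0 : ℝ) one_pos] with t ht
    simpa using ht
  exact ⟨A, B, ⟨hA, he.mono hA'⟩, ⟨hB, he.mono hB'⟩⟩

variable {A B : ℂ → ℂ} {ρ : ℝ}

/-- Holomorphic extensions satisfy the complexified system. -/
lemma hasDerivAt_extension (h : CosineSystem α β) (hρ : 0 < ρ) (hA : ExtendsToBall α A ρ)
    (hB : ExtendsToBall β B ρ) {z : ℂ} (hz : z ∈ Metric.ball (0 : ℂ) ρ) :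
    HasDerivAt A (-Complex.cos (B z)) z ∧ HasDerivAt B (Complex.cos (A z)) z := by
  have hdA := fun w (hw : w ∈ Metric.ball (0 : ℂ) ρ) =>
    hA.1.differentiableAt (Metric.isOpen_ball.mem_nhds hw)
  have hdB := fun w (hw : w ∈ Metric.ball (0 : ℂ) ρ) =>
    hB.1.differentiableAt (Metric.isOpen_ball.mem_nhds hw)
  have hball : ∀ᶠ t : ℝ in 𝓝 0, (t : ℂ) ∈ Metric.ball (0 : ℂ) ρ :=
    (Complex.continuous_ofReal.tendsto 0).eventually
      (by rw [Complex.ofReal_zero]; exact Metric.ball_mem_nhds _ hρ)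
  have hconn : IsPreconnected (Metric.ball (0 : ℂ) ρ) := (convex_ball _ _).isPreconnected
  have h0 : ((0 : ℝ) : ℂ) ∈ Metric.ball (0 : ℂ) ρ := by simpa using hρ
  have haA := (hA.1.analyticOnNhd Metric.isOpen_ball)
  have haB := (hB.1.analyticOnNhd Metric.isOpen_ball)
  constructor
  · have := eqOn_of_real_eventuallyEq (G := fun w => -Complex.cos (B w)) haA.deriv
      (DifferentiableOn.analyticOnNhd (hB.1.ccos.neg) Metric.isOpen_ball) hconn h0 (by
        filter_upwards [hball, hA.2.eventually_nhds, hB.2] with t ht h1 h2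
        obtain ⟨h3, h4⟩ := (hdA t ht).hasDerivAt.real_of_eventuallyEq_ofReal h1
        rw [h4, h3.unique (h.left t), h2]
        push_cast; rfl)
    have hz' : deriv A z = -Complex.cos (B z) := this hz
    exact hz' ▸ (hdA z hz).hasDerivAt
  · have := eqOn_of_real_eventuallyEq (G := fun w => Complex.cos (A w)) haB.deriv
      (DifferentiableOn.analyticOnNhd (hA.1.ccos) Metric.isOpen_ball) hconn h0 (by
        filter_upwards [hball, hB.2.eventually_nhds, hA.2] with t ht h1 h2
        obtain ⟨h3, h4⟩ := (hdB t ht).hasDerivAt.real_of_eventuallyEq_ofReal h1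
        rw [h4, h3.unique (h.right t), h2]
        push_cast; rfl)
    have hz' : deriv B z = Complex.cos (A z) := this hz
    exact hz' ▸ (hdB z hz).hasDerivAt

/-- A priori bound: along a ray the imaginary parts stay below a solution of `y' = c cosh y`. -/
lemma abs_im_extension_le (h : CosineSystem α β) (hρ : 0 < ρ) (hA : ExtendsToBall α A ρ)
    (hB : ExtendsToBall β B ρ) {c : ℝ} (hc : 1 < c) {ζ : ℂ} (hζ : ‖ζ‖ = 1) {s : ℝ} (hs : 0 ≤ s)
    (hsρ : s < ρ) (hcs : c * s < Real.pi / 2) :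
    |(A (s * ζ)).im| ≤ Real.arsinh (Real.tan (c * s)) ∧
      |(B (s * ζ)).im| ≤ Real.arsinh (Real.tan (c * s)) := by
  have hmem : ∀ x ∈ Set.Icc 0 s, (x : ℂ) * ζ ∈ Metric.ball (0 : ℂ) ρ := by
    intro x hx
    simpa [hζ, abs_of_nonneg hx.1] using hx.2.trans_lt hsρ
  have hcos : ∀ x ∈ Set.Icc 0 s, Real.cos (c * x) ≠ 0 := by
    intro x hx
    refine (Real.cos_pos_of_mem_Ioo ⟨?_, ?_⟩).ne'
    · have : 0 ≤ c * x := mul_nonneg (by linarith) hx.1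
      linarith [Real.pi_pos]
    · exact (mul_le_mul_of_nonneg_left hx.2 (by linarith)).trans_lt hcs
  have hder : ∀ x ∈ Set.Icc 0 s, HasDerivAt
      (fun x : ℝ => ((A (x * ζ)).im, (B (x * ζ)).im))
      ((ζ * -Complex.cos (B (x * ζ))).im, (ζ * Complex.cos (A (x * ζ))).im) x := by
    intro x hx
    obtain ⟨h1, h2⟩ := h.hasDerivAt_extension hρ hA hB (hmem x hx)
    have hl : HasDerivAt (fun x : ℝ => (x : ℂ) * ζ) ζ x := by
      simpa using (HasDerivAt.ofReal_comp (hasDerivAt_id x)).mul_const ζ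
    have h3 := h1.scomp x hl
    have h4 := h2.scomp x hl
    exact (Complex.imCLM.hasFDerivAt.comp_hasDerivAt x h3).prodMk
      (Complex.imCLM.hasFDerivAt.comp_hasDerivAt x h4)
  -- The barrier solves Y' = c cosh Y, since cosh (arsinh (tan θ)) = 1/cos θ on the range in
  -- question.
  have hY : ∀ x ∈ Set.Icc 0 s, HasDerivAt (fun x => Real.arsinh (Real.tan (c * x)))
      (c * Real.cosh (Real.arsinh (Real.tan (c * x)))) x := by
    intro x hx
    have h1 : HasDerivAt (fun x => Real.tan (c * x)) (1 / Real.cos (c * x) ^ 2 * c) x := by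
      have := (Real.hasDerivAt_tan (hcos x hx)).comp x ((hasDerivAt_id x).const_mul c)
      simpa using! this
    convert h1.arsinh using 1
    rw [Real.cosh_arsinh]
    have h2 : 1 + Real.tan (c * x) ^ 2 = 1 / Real.cos (c * x) ^ 2 := by
      rw [← Real.inv_one_add_tan_sq (hcos x hx)]; simp
    have h3 : √(1 + Real.tan (c * x) ^ 2) ≠ 0 := by positivity
    rw [← h2, smul_eq_mul]
    field_simp
    rw [Real.sq_sqrt (by positivity)]
  have h0 : ‖((A ((0 : ℝ) * ζ)).im, (B ((0 : ℝ) * ζ)).im)‖ ≤ Real.arsinh (Real.tan (c * 0)) := by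
    have hA0 := hA.2.self_of_nhds
    have hB0 := hB.2.self_of_nhds
    rw [Complex.ofReal_zero] at hA0 hB0
    simp [hA0, hB0]
  -- The norm on the product is the maximum of the two imaginary parts. The comparison principle
  -- asks for a strict inequality of derivatives where the curve meets the barrier; the margin is c
  -- > 1.
  have key := image_norm_le_of_norm_deriv_right_lt_deriv_boundary'
    (f := fun x : ℝ => ((A (x * ζ)).im, (B (x * ζ)).im)) (a := 0) (b := s)
    (fun x hx => (hder x hx).continuousAt.continuousWithinAt)
    (fun x hx => (hder x (Set.Ico_subset_Icc_self hx)).hasDerivWithinAt) h0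
    (fun x hx => (hY x hx).continuousAt.continuousWithinAt)
    (fun x hx => (hY x (Set.Ico_subset_Icc_self hx)).hasDerivWithinAt) (by
      intro x _ hx
      rw [← hx]
      set f := ((A (x * ζ)).im, (B (x * ζ)).im)
      have h1 : |f.1| ≤ ‖f‖ := norm_fst_le f
      have h2 : |f.2| ≤ ‖f‖ := norm_snd_le f
      have h3 : 0 < Real.cosh ‖f‖ := Real.cosh_pos _
      refine lt_of_le_of_lt (b := Real.cosh ‖f‖) ?_ (by nlinarith)
      refine norm_prod_le_iff.2 ⟨?_, ?_⟩
      · refine (Complex.abs_im_le_norm _).trans ?_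
        rw [norm_mul, norm_neg, hζ, one_mul]
        refine (Complex.norm_cos_le_cosh_im _).trans (Real.cosh_le_cosh.2 ?_)
        rwa [abs_of_nonneg (norm_nonneg f)]
      · refine (Complex.abs_im_le_norm _).trans ?_
        rw [norm_mul, hζ, one_mul]
        refine (Complex.norm_cos_le_cosh_im _).trans (Real.cosh_le_cosh.2 ?_)
        rwa [abs_of_nonneg (norm_nonneg f)])
    (Set.right_mem_Icc.2 hs)
  exact norm_prod_le_iff.1 key

/-- On discs of radius at most `r < π / 2` the sines and cosines of holomorphic extensions are
bounded by a constant that depends only on `r`. -/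
lemma exists_bound_extension {r : ℝ} (hr0 : 0 < r) (hr : r < Real.pi / 2) :
    ∃ D > 0, ∀ (α β : ℝ → ℝ) (A B : ℂ → ℂ) (ρ : ℝ), CosineSystem α β → 0 < ρ → ρ ≤ r →
      ExtendsToBall α A ρ → ExtendsToBall β B ρ → ∀ z ∈ Metric.ball (0 : ℂ) ρ,
      ‖Complex.sin (A z)‖ ≤ D ∧ ‖Complex.cos (A z)‖ ≤ D ∧
        ‖Complex.sin (B z)‖ ≤ D ∧ ‖Complex.cos (B z)‖ ≤ D := by
  -- With c = θ/r > 1 the barrier stays below arsinh (tan θ) on the whole disc of radius r, and D is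
  -- the hyperbolic cosine of that value.
  obtain ⟨θ, hθ1, hθ2⟩ := exists_between hr
  set Y := Real.arsinh (Real.tan θ)
  have hY0 : 0 ≤ Y := Real.arsinh_nonneg_iff.2
    (Real.tan_nonneg_of_nonneg_of_le_pi_div_two (by linarith) hθ2.le)
  refine ⟨Real.cosh Y, Real.cosh_pos _, fun α β A B ρ h hρ hρr hA hB z hz => ?_⟩
  have hzρ : ‖z‖ < ρ := by simpa using hz
  obtain ⟨ζ, hζ, hzζ⟩ : ∃ ζ : ℂ, ‖ζ‖ = 1 ∧ (‖z‖ : ℂ) * ζ = z := by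
    rcases eq_or_ne z 0 with rfl | hz0
    · exact ⟨1, by simp, by simp⟩
    · have : (‖z‖ : ℂ) ≠ 0 := by simpa using hz0
      exact ⟨z / ‖z‖, by simp [hz0], by field_simp⟩
  have hc : 1 < θ / r := (one_lt_div hr0).2 hθ1
  have hle : θ / r * ‖z‖ ≤ θ := by
    calc θ / r * ‖z‖ ≤ θ / r * r := by
          gcongr
          linarith
      _ = θ := by field_simp
  obtain ⟨h1, h2⟩ := h.abs_im_extension_le hρ hA hB hc hζ (norm_nonneg z) hzρ (hle.trans_lt hθ2)
  rw [hzζ] at h1 h2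
  have hm : Real.arsinh (Real.tan (θ / r * ‖z‖)) ≤ Y := by
    refine Real.arsinh_le_arsinh.2 ?_
    refine Real.strictMonoOn_tan.monotoneOn ⟨?_, hle.trans_lt hθ2⟩ ⟨?_, hθ2⟩ hle
    · have : 0 ≤ θ / r * ‖z‖ := by positivity
      linarith [Real.pi_pos]
    · linarith [Real.pi_pos]
  have hAY : Real.cosh (A z).im ≤ Real.cosh Y := by
    rw [Real.cosh_le_cosh, abs_of_nonneg hY0]; exact h1.trans hm
  have hBY : Real.cosh (B z).im ≤ Real.cosh Y := by
    rw [Real.cosh_le_cosh, abs_of_nonneg hY0]; exact h2.trans hm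
  exact ⟨(Complex.norm_sin_le_cosh_im _).trans hAY, (Complex.norm_cos_le_cosh_im _).trans hAY,
    (Complex.norm_sin_le_cosh_im _).trans hBY, (Complex.norm_cos_le_cosh_im _).trans hBY⟩

end CosineSystem

/-! ### Continuation to all discs of radius below π/2. -/

/-- A holomorphic germ whose Taylor coefficients are bounded by a geometric sequence extends to
the corresponding disc. -/
lemma ExtendsToBall.exists_of_coeff_le {α : ℝ → ℝ} {A : ℂ → ℂ} {ρ R C : ℝ} (hρ : 0 < ρ)
    (hA : ExtendsToBall α A ρ) (hC : ∀ n, ‖iteratedDeriv n A 0‖ / n ! * R ^ n ≤ C) :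
    ∃ A', ExtendsToBall α A' R := by
  have hc : ∀ n, ‖(n ! : ℂ)⁻¹ * iteratedDeriv n A 0‖ * R ^ n ≤ C := by
    intro n
    rw [norm_mul, norm_inv, Complex.norm_natCast, inv_mul_eq_div]
    exact hC n
  refine ⟨_, (differentiableOn_tsum_pow hc).1, ?_⟩
  have hball : ∀ᶠ t : ℝ in 𝓝 0, (t : ℂ) ∈ Metric.ball (0 : ℂ) ρ :=
    (Complex.continuous_ofReal.tendsto 0).eventually
      (by rw [Complex.ofReal_zero]; exact Metric.ball_mem_nhds _ hρ)
  filter_upwards [hA.2, hball] with t ht hb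
  rw [← ht, ← Complex.taylorSeries_eq_on_ball' hb hA.1]
  refine tsum_congr fun n => ?_
  rw [sub_zero]; ring

/-- The gain 1/(n + 1) from integrating `g` is discarded. Leaving out the order-0 coefficient keeps
`A 0` out of the bound, as uniformity over all solutions requires. -/
lemma coeff_succ_le {A : ℂ → ℂ} {g : ℂ → ℂ} {R C : ℝ} (hR : 0 ≤ R)
    (hg : deriv A =ᶠ[𝓝 0] g) (hC : ∀ n, ‖iteratedDeriv n g 0‖ / n ! * R ^ n ≤ C) (n : ℕ) :
    ‖iteratedDeriv (n + 1) A 0‖ / (n + 1)! * R ^ (n + 1) ≤ C * R := by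
  rw [iteratedDeriv_succ', hg.iteratedDeriv_eq, pow_succ, ← mul_assoc]
  refine mul_le_mul_of_nonneg_right (le_trans ?_ (hC n)) hR
  gcongr
  exact Nat.le_succ n

lemma coeff_le_of_deriv {A : ℂ → ℂ} {g : ℂ → ℂ} {R C : ℝ} (hR : 0 ≤ R)
    (hg : deriv A =ᶠ[𝓝 0] g) (hC : ∀ n, ‖iteratedDeriv n g 0‖ / n ! * R ^ n ≤ C) (n : ℕ) :
    ‖iteratedDeriv n A 0‖ / n ! * R ^ n ≤ ‖A 0‖ + C * R := by
  have hC0 : 0 ≤ C := le_trans (by positivity) (hC 0)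
  cases n with
  | zero => simp; positivity
  | succ n => linarith [coeff_succ_le hR hg hC n, norm_nonneg (A 0)]

namespace CosineSystem

variable {α β : ℝ → ℝ} {A B : ℂ → ℂ} {ρ : ℝ}

lemma deriv_extension_eventuallyEq (h : CosineSystem α β) (hρ : 0 < ρ)
    (hA : ExtendsToBall α A ρ) (hB : ExtendsToBall β B ρ) :
    deriv A =ᶠ[𝓝 0] (fun z => -Complex.cos (B z)) ∧ deriv B =ᶠ[𝓝 0] fun z => Complex.cos (A z) := by
  have hb := Metric.ball_mem_nhds (0 : ℂ) hρ
  exact ⟨by filter_upwards [hb] with z hz using (h.hasDerivAt_extension hρ hA hB hz).1.deriv,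
    by filter_upwards [hb] with z hz using (h.hasDerivAt_extension hρ hA hB hz).2.deriv⟩

/-- Bounded sines and cosines allow an extension to a disc whose radius is larger by an amount that
depends on the bound only. -/
lemma exists_larger_extension (h : CosineSystem α β) (hρ : 0 < ρ)
    (hA : ExtendsToBall α A ρ) (hB : ExtendsToBall β B ρ) {D : ℝ} (hD : 0 < D)
    (hAB : ∀ z ∈ Metric.ball (0 : ℂ) ρ, ‖Complex.sin (A z)‖ ≤ D ∧ ‖Complex.cos (A z)‖ ≤ D ∧
        ‖Complex.sin (B z)‖ ≤ D ∧ ‖Complex.cos (B z)‖ ≤ D) :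
    ∃ A' B', ExtendsToBall α A' (ρ + 1 / (2 * D)) ∧ ExtendsToBall β B' (ρ + 1 / (2 * D)) := by
  have hs : ∀ f : ℂ → ℂ, DifferentiableOn ℂ f (Metric.ball 0 ρ) →
      ∀ x ∈ Metric.ball (0 : ℂ) ρ, ∀ n : ℕ, ContDiffAt ℂ n f x := fun f hf x hx n =>
    (hf.analyticOnNhd Metric.isOpen_ball x hx).contDiffAt
  have hn := norm_iteratedDeriv_le_of_cosineSystem (𝕜 := ℂ)
    (U := Metric.ball 0 ρ) Metric.isOpen_ball
    (sa := fun z => Complex.sin (A z)) (ca := fun z => Complex.cos (A z))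
    (sb := fun z => Complex.sin (B z)) (cb := fun z => Complex.cos (B z)) (D := D)
    (fun x hx => by simpa using (h.hasDerivAt_extension hρ hA hB hx).1.csin)
    (fun x hx => by simpa using (h.hasDerivAt_extension hρ hA hB hx).1.ccos)
    (fun x hx => by simpa using (h.hasDerivAt_extension hρ hA hB hx).2.csin)
    (fun x hx => by simpa using (h.hasDerivAt_extension hρ hA hB hx).2.ccos)
    (fun x hx n => ⟨hs _ hA.1.csin x hx n, hs _ hA.1.ccos x hx n, hs _ hB.1.csin x hx n,
      hs _ hB.1.ccos x hx n⟩) hAB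
  -- The coefficient estimate is applied to cos A and cos B, which are up to sign the derivatives of
  -- B and A and are bounded by D.
  have h1 := norm_iteratedDeriv_zero_mul_pow_le hρ hD hA.1.ccos fun n z hz => (hn n z hz).1
  have h2 := norm_iteratedDeriv_zero_mul_pow_le hρ hD hB.1.ccos fun n z hz => (hn n z hz).2
  obtain ⟨hdA, hdB⟩ := h.deriv_extension_eventuallyEq hρ hA hB
  have hR : 0 ≤ ρ + 1 / (2 * D) := by positivity
  obtain ⟨A', hA'⟩ := hA.exists_of_coeff_le hρ (coeff_le_of_deriv hR hdA (fun n => by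
    rw [iteratedDeriv_fun_neg, norm_neg]; exact h2 n))
  obtain ⟨B', hB'⟩ := hB.exists_of_coeff_le hρ (coeff_le_of_deriv hR hdB h1)
  exact ⟨A', B', hA', hB'⟩

/-- Every disc met on the way has radius at most r, so a single D serves for all steps; each step
gains 1/(2D), and the cap `min r` keeps that D valid. -/
lemma exists_extension (h : CosineSystem α β) {r : ℝ} (hr0 : 0 < r) (hr : r < Real.pi / 2) :
    ∃ A B, ExtendsToBall α A r ∧ ExtendsToBall β B r := by
  obtain ⟨D, hD, hbd⟩ := exists_bound_extension hr0 hr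
  have step : ∀ k : ℕ, ∃ A B, ExtendsToBall α A (min r (1 + k * (1 / (2 * D)))) ∧
      ExtendsToBall β B (min r (1 + k * (1 / (2 * D)))) := by
    intro k
    induction k with
    | zero =>
      obtain ⟨A, B, hA, hB⟩ := h.exists_extendsToBall_one
      exact ⟨A, B, hA.mono (by simp), hB.mono (by simp)⟩
    | succ k ih =>
      obtain ⟨A, B, hA, hB⟩ := ih
      have hpos : 0 < min r (1 + k * (1 / (2 * D))) := lt_min hr0 (by positivity)
      obtain ⟨A', B', hA', hB'⟩ := h.exists_larger_extension hpos hA hB hD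
        (hbd α β A B _ h hpos (min_le_left _ _) hA hB)
      have hle : min r (1 + ((k + 1 : ℕ) : ℝ) * (1 / (2 * D))) ≤
          min r (1 + k * (1 / (2 * D))) + 1 / (2 * D) := by
        rw [min_add]
        refine le_min ((min_le_left _ _).trans ?_) ((min_le_right _ _).trans (le_of_eq ?_))
        · have : 0 < 1 / (2 * D) := by positivity
          linarith
        · push_cast; ring
      exact ⟨A', B', hA'.mono hle, hB'.mono hle⟩
  obtain ⟨k, hk⟩ := exists_nat_gt (r * (2 * D))
  obtain ⟨A, B, hA, hB⟩ := step k
  have : r ≤ 1 + k * (1 / (2 * D)) := by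
    have : r ≤ k * (1 / (2 * D)) := by
      rw [mul_one_div, le_div_iff₀ (by positivity)]; exact hk.le
    linarith
  rw [min_eq_left this] at hA hB
  exact ⟨A, B, hA, hB⟩

/-- Solutions extend holomorphically to every disc of radius less than `π / 2`, with bounds on the
Taylor coefficients that do not depend on the solution. -/
lemma exists_extension_coeff_le {r : ℝ} (hr0 : 0 < r) (hr : r < Real.pi / 2) :
    ∃ C, ∀ α β : ℝ → ℝ, CosineSystem α β → ∃ A B, ExtendsToBall α A r ∧ ExtendsToBall β B r ∧
      ∀ n : ℕ, ‖iteratedDeriv (n + 1) A 0‖ / (n + 1)! * r ^ (n + 1) ≤ C ∧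
        ‖iteratedDeriv (n + 1) B 0‖ / (n + 1)! * r ^ (n + 1) ≤ C := by
  -- Room for Cauchy's estimate on the circle of radius r. The bound D for the cosines yields `D *
  -- r` for the coefficients after one integration.
  obtain ⟨R, hrR, hR⟩ := exists_between hr
  have hR0 : 0 < R := hr0.trans hrR
  obtain ⟨D, hD, hbd⟩ := exists_bound_extension hR0 hR
  refine ⟨D * r, fun α β h => ?_⟩
  obtain ⟨A, B, hA, hB⟩ := h.exists_extension hR0 hR
  obtain ⟨hdA, hdB⟩ := h.deriv_extension_eventuallyEq hR0 hA hB
  have hAB := hbd α β A B R h hR0 le_rfl hA hB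
  have cauchy : ∀ g : ℂ → ℂ, DifferentiableOn ℂ g (Metric.ball 0 R) →
      (∀ z ∈ Metric.ball (0 : ℂ) R, ‖g z‖ ≤ D) → ∀ n : ℕ,
      ‖iteratedDeriv n g 0‖ / n ! * r ^ n ≤ D := by
    intro g hg hgD n
    have hb := Metric.closedBall_subset_ball (x := (0 : ℂ)) hrR
    have hd : DiffContOnCl ℂ g (Metric.ball 0 r) := by
      refine DifferentiableOn.diffContOnCl ?_
      rw [closure_ball _ hr0.ne']
      exact hg.mono hb
    have := Complex.norm_iteratedDeriv_le_of_forall_mem_sphere_norm_le n hr0 hd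
      (fun z hz => hgD z (hb (Metric.sphere_subset_closedBall hz)))
    rw [le_div_iff₀ (by positivity)] at this
    rw [div_mul_eq_mul_div, div_le_iff₀ (by positivity)]
    linarith
  refine ⟨A, B, hA.mono hrR.le, hB.mono hrR.le, fun n => ⟨?_, ?_⟩⟩
  · exact coeff_succ_le hr0.le hdA (cauchy _ hB.1.ccos.neg fun z hz => by
      rw [norm_neg]; exact (hAB z hz).2.2.2) n
  · exact coeff_succ_le hr0.le hdB (cauchy _ hA.1.ccos fun z hz => (hAB z hz).2.1) n

end CosineSystem

/-! ### From discs around real times to a strip. -/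

/-- The real derivatives at `0` are the complex ones. -/
lemma ExtendsToBall.iteratedDeriv_eq {α : ℝ → ℝ} {A : ℂ → ℂ} {ρ : ℝ} (hρ : 0 < ρ)
    (hA : ExtendsToBall α A ρ) (n : ℕ) :
    iteratedDeriv n A 0 = ((iteratedDeriv n α 0 : ℝ) : ℂ) := by
  have hball : ∀ᶠ t : ℝ in 𝓝 0, (t : ℂ) ∈ Metric.ball (0 : ℂ) ρ :=
    (Complex.continuous_ofReal.tendsto 0).eventually
      (by rw [Complex.ofReal_zero]; exact Metric.ball_mem_nhds _ hρ)
  have han : AnalyticOnNhd ℂ A (Metric.ball 0 ρ) := hA.1.analyticOnNhd Metric.isOpen_ball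
  -- Equality on a real neighbourhood of 0, rather than at 0 alone, can be differentiated in the
  -- induction.
  have key : ∀ᶠ t : ℝ in 𝓝 0, iteratedDeriv n A t = ((iteratedDeriv n α t : ℝ) : ℂ) := by
    induction n with
    | zero => simpa using hA.2
    | succ n ih =>
      filter_upwards [ih.eventually_nhds, hball] with t ht hb
      have hd : HasDerivAt (iteratedDeriv n A) (iteratedDeriv (n + 1) A t) t := by
        rw [iteratedDeriv_succ, iteratedDeriv_eq_iterate]
        exact ((han.iterated_deriv n) _ hb).differentiableAt.hasDerivAt
      obtain ⟨h1, h2⟩ := hd.real_of_eventuallyEq_ofReal ht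
      rw [h2, iteratedDeriv_succ (f := α), h1.deriv]
  simpa using key.self_of_nhds

lemma ExtendsToBall.analyticAt {α : ℝ → ℝ} {A : ℂ → ℂ} {ρ : ℝ} (hρ : 0 < ρ)
    (hA : ExtendsToBall α A ρ) : AnalyticAt ℝ α 0 := by
  have h0 : ((0 : ℝ) : ℂ) ∈ Metric.ball (0 : ℂ) ρ := by simpa using hρ
  have := (hA.1.analyticOnNhd Metric.isOpen_ball _ h0).re_ofReal
  refine this.congr ?_
  filter_upwards [hA.2] with t ht
  simp [ht]

/-- If every translate of `α` extends to the disc of radius `r`, then the extension is valid on the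
whole real diameter. -/
lemma ExtendsToBall.eq_ofReal {α : ℝ → ℝ} {r : ℝ} (hr : 0 < r)
    (h : ∀ t₀, ∃ A, ExtendsToBall (fun t => α (t₀ + t)) A r) {A : ℂ → ℂ}
    (hA : ExtendsToBall α A r) {t : ℝ} (ht : |t| < r) : A t = α t := by
  -- The translates make α real-analytic at every real point; the identity theorem then carries the
  -- equality of germs at 0 along the whole diameter.
  have hα : ∀ t₀, AnalyticAt ℝ α t₀ := by
    intro t₀
    obtain ⟨A, hA⟩ := h t₀
    have h1 := hA.analyticAt hr
    have h2 : AnalyticAt ℝ (fun t => t - t₀) t₀ := by fun_prop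
    have h3 : AnalyticAt ℝ (fun t => α (t₀ + t)) ((fun t => t - t₀) t₀) := by simpa using h1
    have := AnalyticAt.comp (g := fun t => α (t₀ + t)) (f := fun t => t - t₀) h3 h2
    simpa [Function.comp_def] using this
  have hcast : ∀ t₀, AnalyticAt ℝ (fun t : ℝ => (α t : ℂ)) t₀ := fun t₀ =>
    (Complex.ofRealCLM.analyticAt _).comp (hα t₀)
  have han : AnalyticOnNhd ℝ (fun t : ℝ => A t) (Metric.ball 0 r) := by
    intro t ht
    have h1 : AnalyticAt ℂ A (t : ℂ) := hA.1.analyticOnNhd Metric.isOpen_ball _ (by simpa using ht)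
    exact (h1.restrictScalars (𝕜 := ℝ)).comp (f := fun t : ℝ => (t : ℂ))
      (Complex.ofRealCLM.analyticAt t)
  exact han.eqOn_of_preconnected_of_eventuallyEq (fun t _ => hcast t)
    (convex_ball _ _).isPreconnected (z₀ := 0) (by simpa using hr) hA.2 (by simpa using ht)

/-- If every translate of `α` extends to the disc of radius `r`, then `α` extends to the strip
`|Im z| < r`. -/
lemma exists_extension_strip {α : ℝ → ℝ} {r : ℝ} (hr : 0 < r)
    (h : ∀ t₀, ∃ A, ExtendsToBall (fun t => α (t₀ + t)) A r) :
    ∃ F : ℂ → ℂ, DifferentiableOn ℂ F {z | |z.im| < r} ∧ ∀ t : ℝ, F t = α t := by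
  choose A hA using h
  have hreal : ∀ t₀ t : ℝ, |t| < r → A t₀ t = α (t₀ + t) := fun t₀ t ht =>
    (hA t₀).eq_ofReal hr (fun t₁ => ⟨A (t₀ + t₁), by simpa [add_assoc] using hA (t₀ + t₁)⟩) ht
  -- The intersection of the two discs is convex and contains the real point s, near which both
  -- functions are the real solution.
  have overlap : ∀ t₀ s : ℝ, |s| < r → ∀ z : ℂ, ‖z‖ < r → ‖z - s‖ < r →
      A t₀ z = A (t₀ + s) (z - s) := by
    intro t₀ s hs z hz hzs
    have hV : IsPreconnected (Metric.ball (0 : ℂ) r ∩ Metric.ball (s : ℂ) r) :=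
      ((convex_ball _ _).inter (convex_ball _ _)).isPreconnected
    refine eqOn_of_real_eventuallyEq (F := A t₀) (G := fun z => A (t₀ + s) (z - s)) (x := s)
      (((hA t₀).1.analyticOnNhd Metric.isOpen_ball).mono Set.inter_subset_left) ?_ hV ?_ ?_ ?_
    · have : DifferentiableOn ℂ (fun z => A (t₀ + s) (z - s)) (Metric.ball (s : ℂ) r) := by
        refine (hA (t₀ + s)).1.comp (by fun_prop) fun w hw => ?_
        simpa [dist_eq_norm] using hw
      exact (this.analyticOnNhd Metric.isOpen_ball).mono Set.inter_subset_right
    · simpa [hr] using hs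
    · have h1 : ∀ᶠ t in 𝓝 s, |t| < r := (continuous_abs.tendsto s).eventually (gt_mem_nhds hs)
      have h2 : ∀ᶠ t in 𝓝 s, |t - s| < r :=
        ((show Continuous fun t : ℝ => |t - s| by fun_prop).tendsto s).eventually
          (gt_mem_nhds (by simpa using hr))
      filter_upwards [h1, h2] with t h1 h2
      rw [hreal t₀ t h1, ← Complex.ofReal_sub, hreal (t₀ + s) (t - s) h2]
      congr 2; ring
    · simpa [dist_eq_norm] using ⟨hz, hzs⟩
  -- Each z is evaluated in the disc centred at its real part. Near z₀ this agrees, by `overlap`,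
  -- with the fixed extension centred at Re z₀, hence it is holomorphic.
  refine ⟨fun z => A z.re (z - z.re), fun z₀ hz₀ => ?_, fun t => ?_⟩
  · have hd : DifferentiableAt ℂ (fun z => A z₀.re (z - z₀.re)) z₀ := by
      have h1 : DifferentiableAt ℂ (A z₀.re) (z₀ - z₀.re) := by
        refine (hA z₀.re).1.differentiableAt (Metric.isOpen_ball.mem_nhds ?_)
        have : z₀ - z₀.re = z₀.im * Complex.I := by
          apply Complex.ext <;> simp
        rw [this]
        simpa using hz₀
      exact h1.comp z₀ (f := fun z => z - (z₀.re : ℂ)) (by fun_prop)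
    refine (hd.congr_of_eventuallyEq ?_).differentiableWithinAt
    have h1 : ∀ᶠ z in 𝓝 z₀, |z.im| < r :=
      ((show Continuous fun z : ℂ => |z.im| by fun_prop).tendsto z₀).eventually (gt_mem_nhds hz₀)
    have h2 : ∀ᶠ z in 𝓝 z₀, |z.re - z₀.re| < r :=
      ((show Continuous fun z : ℂ => |z.re - z₀.re| by fun_prop).tendsto z₀).eventually
        (gt_mem_nhds (by simpa using hr))
    have h3 : ∀ᶠ z : ℂ in 𝓝 z₀, ‖z - z₀.re‖ < r := by
      refine ((show Continuous fun z : ℂ => ‖z - z₀.re‖ by fun_prop).tendsto z₀).eventually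
        (gt_mem_nhds ?_)
      have : z₀ - z₀.re = z₀.im * Complex.I := by
        apply Complex.ext <;> simp
      simpa [this] using hz₀
    filter_upwards [h1, h2, h3] with z h1 h2 h3
    have h4 : z - z₀.re - ((z.re - z₀.re : ℝ) : ℂ) = z.im * Complex.I := by
      apply Complex.ext <;> simp
    have := overlap z₀.re (z.re - z₀.re) h2 (z - z₀.re) h3 (by rw [h4]; simpa using h1)
    rw [this]
    congr 1
    · ring_nf
    · push_cast; ring
  · simpa using hreal t 0 (by simpa using hr)

/-! ### Two facts on ordinary differential equations. -/

/-- A bounded, globally Lipschitz vector field has global integral curves. -/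
lemma exists_global_integralCurve {E : Type*} [NormedAddCommGroup E] [NormedSpace ℝ E]
    [CompleteSpace E] {v : E → E} {K L : ℝ≥0} (hK : LipschitzWith K v) (hL : ∀ x, ‖v x‖ ≤ L)
    (a : E) : ∃ x : ℝ → E, x 0 = a ∧ ∀ t, HasDerivAt x (v (x t)) t := by
  have local_sol : ∀ n : ℕ, ∃ y : ℝ → E, y 0 = a ∧
      ∀ t ∈ Set.Ioo (-(n + 1 : ℝ)) (n + 1), HasDerivAt y (v (y t)) t := by
    intro n
    have hn : (0 : ℝ) < n + 1 := by positivity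
    have hp : IsPicardLindelof (fun _ => v) (tmin := -(n + 1 : ℝ)) (tmax := n + 1)
        ⟨0, by constructor <;> linarith⟩ a (L * (n + 1)) 0 L K :=
      IsPicardLindelof.of_time_independent (fun x _ => hL x) hK.lipschitzOnWith (by simp)
    obtain ⟨y, hy0, hy⟩ := hp.exists_eq_forall_mem_Icc_hasDerivWithinAt₀
    exact ⟨y, hy0, fun t ht => (hy t (Set.Ioo_subset_Icc_self ht)).hasDerivAt
      (Icc_mem_nhds ht.1 ht.2)⟩
  choose y hy0 hy using local_sol
  have agree : ∀ m n : ℕ, m ≤ n → Set.EqOn (y m) (y n) (Set.Ioo (-(m + 1 : ℝ)) (m + 1)) := by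
    intro m n hmn
    have hm : (0 : ℝ) < m + 1 := by positivity
    have hmn' : (m : ℝ) ≤ n := by exact_mod_cast hmn
    refine ODE_solution_unique_of_mem_Ioo (v := fun _ => v) (s := fun _ => Set.univ) (K := K)
      (t₀ := 0) (fun _ _ => hK.lipschitzOnWith) ⟨by linarith, hm⟩
      (fun t ht => ⟨hy m t ht, trivial⟩)
      (fun t ht => ⟨hy n t ⟨by linarith [ht.1], by linarith [ht.2]⟩, trivial⟩) ?_
    rw [hy0, hy0]
  -- `y n` solves the equation up to time n + 1, so the index ⌈|s|⌉₊ leaves a margin around s.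
  have eq_of_lt : ∀ (N : ℕ) (s : ℝ), |s| < N → y ⌈|s|⌉₊ s = y N s := by
    intro N s hs
    refine agree _ N (Nat.ceil_le.2 hs.le) ?_
    have := Nat.le_ceil |s|
    rw [Set.mem_Ioo, ← abs_lt]
    linarith
  refine ⟨fun t => y ⌈|t|⌉₊ t, by simp [hy0], fun t => ?_⟩
  obtain ⟨N, hN⟩ := exists_nat_gt |t|
  have h1 : HasDerivAt (y N) (v (y N t)) t := by
    refine hy N t ?_
    rw [Set.mem_Ioo, ← abs_lt]
    linarith
  simp only [eq_of_lt N t hN]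
  refine h1.congr_of_eventuallyEq ?_
  filter_upwards [(continuous_abs.tendsto t).eventually (gt_mem_nhds hN)] with s hs
  exact eq_of_lt N s hs

/-- A solution of a linear equation `y' = g y` with bounded `g` vanishes identically if it vanishes
at one time. -/
lemma eq_zero_of_linear_ode {y g : ℝ → ℝ} {K : ℝ≥0} (hy : ∀ t, HasDerivAt y (g t * y t) t)
    (hg : ∀ t, |g t| ≤ K) {t₀ : ℝ} (h0 : y t₀ = 0) (t : ℝ) : y t = 0 := by
  have := ODE_solution_unique_univ (v := fun t z => g t * z) (s := fun _ => Set.univ) (K := K)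
    (f := y) (g := fun _ => 0) (t₀ := t₀)
    (fun t => by
      refine LipschitzWith.lipschitzOnWith (LipschitzWith.of_dist_le_mul fun a b => ?_)
      rw [Real.dist_eq, Real.dist_eq, ← mul_sub, abs_mul]
      gcongr
      exact hg t)
    (fun t => ⟨hy t, trivial⟩) (fun t => ⟨by simpa using hasDerivAt_const t (0 : ℝ), trivial⟩) h0
  exact congrFun this t

/-! ### The AB flow: Lagrangian map, Euler equations, Beltrami property. -/

lemma E3.norm_le_sum_abs (x : E3) : ‖x‖ ≤ |x 0| + |x 1| + |x 2| := by
  rw [EuclideanSpace.norm_eq, Fin.sum_univ_three]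
  refine Real.sqrt_le_iff.2 ⟨by positivity, ?_⟩
  simp only [Real.norm_eq_abs]
  nlinarith [mul_nonneg (abs_nonneg (x 0)) (abs_nonneg (x 1)),
    mul_nonneg (abs_nonneg (x 0)) (abs_nonneg (x 2)),
    mul_nonneg (abs_nonneg (x 1)) (abs_nonneg (x 2))]

lemma E3.abs_apply_le_norm (x : E3) (i : Fin 3) : |x i| ≤ ‖x‖ := PiLp.norm_apply_le x i

@[simp] lemma abFlow_zero (x : E3) : abFlow x 0 = -(Real.sin (x 0) * Real.sin (x 1)) := rfl
@[simp] lemma abFlow_one (x : E3) : abFlow x 1 = -(Real.cos (x 0) * Real.cos (x 1)) := rfl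
@[simp] lemma abFlow_two (x : E3) : abFlow x 2 = √2 * Real.sin (x 0) * Real.cos (x 1) := rfl

lemma norm_abFlow_le (x : E3) : ‖abFlow x‖ ≤ (4 : ℝ≥0) := by
  refine (E3.norm_le_sum_abs _).trans ?_
  have h2 : √2 ≤ 2 := Real.sqrt_le_iff.2 ⟨by norm_num, by norm_num⟩
  have key : ∀ a b : ℝ, |a| ≤ 1 → |b| ≤ 1 → |a * b| ≤ 1 := fun a b ha hb => by
    rw [abs_mul]; exact mul_le_one₀ ha (abs_nonneg _) hb
  have e1 := key _ _ (Real.abs_sin_le_one (x 0)) (Real.abs_sin_le_one (x 1))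
  have e2 := key _ _ (Real.abs_cos_le_one (x 0)) (Real.abs_cos_le_one (x 1))
  have e3 := key _ _ (Real.abs_sin_le_one (x 0)) (Real.abs_cos_le_one (x 1))
  simp only [abFlow_zero, abFlow_one, abFlow_two, abs_neg]
  rw [mul_assoc, abs_mul √2, abs_of_nonneg (Real.sqrt_nonneg 2)]
  have : √2 * |Real.sin (x 0) * Real.cos (x 1)| ≤ 2 * 1 := by gcongr
  push_cast
  linarith

lemma lipschitzWith_abFlow : LipschitzWith 8 abFlow := by
  refine LipschitzWith.of_dist_le_mul fun x y => ?_
  rw [dist_eq_norm, dist_eq_norm]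
  refine (E3.norm_le_sum_abs _).trans ?_
  have h2 : √2 ≤ 2 := Real.sqrt_le_iff.2 ⟨by norm_num, by norm_num⟩
  have key : ∀ a b c d : ℝ, |b| ≤ 1 → |c| ≤ 1 → |a - c| ≤ ‖x - y‖ → |b - d| ≤ ‖x - y‖ →
      |a * b - c * d| ≤ 2 * ‖x - y‖ := fun a b c d hb hc h1 h3 => by
    have : a * b - c * d = (a - c) * b + c * (b - d) := by ring
    rw [this]
    refine (abs_add_le _ _).trans ?_
    rw [abs_mul, abs_mul]
    nlinarith [mul_le_mul h1 hb (abs_nonneg _) (norm_nonneg _),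
      mul_le_mul hc h3 (abs_nonneg _) zero_le_one]
  have hs : ∀ i, |Real.sin (x i) - Real.sin (y i)| ≤ ‖x - y‖ := fun i =>
    (by simpa [Real.dist_eq] using Real.lipschitzWith_sin.dist_le_mul (x i) (y i) :
      _ ≤ |x i - y i|).trans (E3.abs_apply_le_norm (x - y) i)
  have hc : ∀ i, |Real.cos (x i) - Real.cos (y i)| ≤ ‖x - y‖ := fun i =>
    (by simpa [Real.dist_eq] using Real.lipschitzWith_cos.dist_le_mul (x i) (y i) :
      _ ≤ |x i - y i|).trans (E3.abs_apply_le_norm (x - y) i)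
  have e1 := key _ _ _ _ (Real.abs_sin_le_one (x 1)) (Real.abs_sin_le_one (y 0)) (hs 0) (hs 1)
  have e2 := key _ _ _ _ (Real.abs_cos_le_one (x 1)) (Real.abs_cos_le_one (y 0)) (hc 0) (hc 1)
  have e3 := key _ _ _ _ (Real.abs_cos_le_one (x 1)) (Real.abs_sin_le_one (y 0)) (hs 0) (hc 1)
  simp only [PiLp.sub_apply, abFlow_zero, abFlow_one, abFlow_two]
  rw [neg_sub_neg, neg_sub_neg, abs_sub_comm, abs_sub_comm (Real.cos (y 0) * _), mul_assoc,
    mul_assoc, ← mul_sub, abs_mul √2, abs_of_nonneg (Real.sqrt_nonneg 2)]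
  have : √2 * |Real.sin (x 0) * Real.cos (x 1) - Real.sin (y 0) * Real.cos (y 1)| ≤
      2 * (2 * ‖x - y‖) := by gcongr
  push_cast
  linarith

lemma existsUnique_isLagrangianMap_abFlow : ∃! X : E3 → ℝ → E3, IsLagrangianMap abFlow X := by
  choose X hX using exists_global_integralCurve lipschitzWith_abFlow norm_abFlow_le
  refine ⟨X, hX, fun Y hY => ?_⟩
  funext a
  exact ODE_solution_unique_univ (v := fun _ => abFlow) (s := fun _ => Set.univ) (t₀ := 0)
    (fun _ => lipschitzWith_abFlow.lipschitzOnWith) (fun t => ⟨(hY a).2 t, trivial⟩)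
    (fun t => ⟨(hX a).2 t, trivial⟩) ((hY a).1.trans (hX a).1.symm)

lemma contDiff_abFlow : ContDiff ℝ 1 abFlow := by
  rw [contDiff_euclidean]
  have h : ∀ i : Fin 3, ContDiff ℝ 1 fun x : E3 => x i := fun i =>
    (EuclideanSpace.proj (𝕜 := ℝ) i).contDiff
  intro i
  fin_cases i
  · exact ((h 0).sin.mul (h 1).sin).neg
  · exact ((h 0).cos.mul (h 1).cos).neg
  · exact (contDiff_const.mul (h 0).sin).mul (h 1).cos

/-- Restricting to the line s ↦ x + s • w reduces this to one-variable calculus. Divergence, curl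
and the advection term are all read off from it. -/
lemma fderiv_abFlow_apply (x w : E3) :
    fderiv ℝ abFlow x w = !₂[
      -(Real.cos (x 0) * w 0 * Real.sin (x 1) + Real.sin (x 0) * (Real.cos (x 1) * w 1)),
      Real.sin (x 0) * w 0 * Real.cos (x 1) + Real.cos (x 0) * (Real.sin (x 1) * w 1),
      √2 * (Real.cos (x 0) * w 0 * Real.cos (x 1) - Real.sin (x 0) * (Real.sin (x 1) * w 1))] := by
  have h1 : HasFDerivAt abFlow (fderiv ℝ abFlow x) x :=
    (contDiff_abFlow.differentiable one_ne_zero x).hasFDerivAt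
  have hline : HasDerivAt (fun s : ℝ => x + s • w) w 0 := by
    simpa using ((hasDerivAt_id (0 : ℝ)).smul_const w).const_add x
  have h2 : HasDerivAt (fun s : ℝ => abFlow (x + s • w)) (fderiv ℝ abFlow x w) 0 :=
    HasFDerivAt.comp_hasDerivAt (l := abFlow) (f := fun s : ℝ => x + s • w) 0 (by simpa using h1) hline
  have h3 : ∀ i, HasDerivAt (fun s : ℝ => abFlow (x + s • w) i) (fderiv ℝ abFlow x w i) 0 :=
    fun i => (EuclideanSpace.proj (𝕜 := ℝ) i).hasFDerivAt.comp_hasDerivAt 0 h2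
  have hc : ∀ i, HasDerivAt (fun s : ℝ => (x + s • w) i) (w i) 0 := fun i =>
    (EuclideanSpace.proj (𝕜 := ℝ) i).hasFDerivAt.comp_hasDerivAt 0 hline
  ext i
  fin_cases i
  · refine (h3 0).unique ?_
    exact ((hc 0).sin.fun_mul (hc 1).sin).fun_neg.congr_deriv (by simp)
  · refine (h3 1).unique ?_
    exact ((hc 0).cos.fun_mul (hc 1).cos).fun_neg.congr_deriv (by simp; ring)
  · refine (h3 2).unique ?_
    exact (((hc 0).sin.const_mul √2).fun_mul (hc 1).cos).congr_deriv (by simp; ring)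

lemma isSteadyEuler_abFlow : IsSteadyEuler abFlow := by
  -- For a Beltrami field (v · ∇)v = ∇|v|²/2. Here |v|² = 1 + sin² x₁ - sin² x₂, so this pressure is
  -- (1 - |v|²)/2.
  refine ⟨contDiff_abFlow, fun x => ?_, fun x => (Real.sin (x 1) ^ 2 - Real.sin (x 0) ^ 2) / 2,
    ?_, fun x => ?_⟩
  · simp [divergence, partialD, Fin.sum_univ_three, fderiv_abFlow_apply]
  · have h : ∀ i : Fin 3, ContDiff ℝ 1 fun x : E3 => x i := fun i =>
      (EuclideanSpace.proj (𝕜 := ℝ) i).contDiff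
    exact (((h 1).sin.pow 2).sub ((h 0).sin.pow 2)).div_const 2
  · have hg : HasGradientAt (fun x : E3 => (Real.sin (x 1) ^ 2 - Real.sin (x 0) ^ 2) / 2)
        (!₂[-(Real.sin (x 0) * Real.cos (x 0)), Real.sin (x 1) * Real.cos (x 1), 0]) x := by
      rw [hasGradientAt_iff_hasFDerivAt]
      have hp : ∀ i : Fin 3, HasFDerivAt (fun x : E3 => x i) (EuclideanSpace.proj (𝕜 := ℝ) i) x :=
        fun i => (EuclideanSpace.proj (𝕜 := ℝ) i).hasFDerivAt
      have := ((((hp 1).sin.pow 2).sub ((hp 0).sin.pow 2)).mul_const (1 / 2))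
      refine (this.congr_fderiv ?_).congr_of_eventuallyEq (.of_forall fun y => ?_)
      · ext w
        simp [PiLp.inner_apply, Fin.sum_univ_three]
        ring
      · simp; ring
    rw [hg.gradient, fderiv_abFlow_apply]
    ext i
    fin_cases i
    · simp
      linear_combination (Real.sin (x 0) * Real.cos (x 0)) * Real.sin_sq_add_cos_sq (x 1)
    · simp
      linear_combination (-(Real.sin (x 1) * Real.cos (x 1))) * Real.sin_sq_add_cos_sq (x 0)
    · simp
      ring

lemma curl_abFlow (x : E3) : curl abFlow x = √2 • abFlow x := by
  have h2 : √2 * √2 = 2 := Real.mul_self_sqrt (by norm_num)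
  ext i
  fin_cases i
  · simp [curl, partialD, fderiv_abFlow_apply]
  · simp [curl, partialD, fderiv_abFlow_apply]
  · simp [curl, partialD, fderiv_abFlow_apply]
    linear_combination (-(Real.sin (x 0) * Real.cos (x 1))) * h2

/-! ### Planar motion and its integration. -/

/-- The horizontal part of a trajectory of the AB flow. -/
structure PlanarAB (x y : ℝ → ℝ) : Prop where
  fst : ∀ t, HasDerivAt x (-(Real.sin (x t) * Real.sin (y t))) t
  snd : ∀ t, HasDerivAt y (-(Real.cos (x t) * Real.cos (y t))) t

lemma IsLagrangianMap.hasDerivAt_apply {v : E3 → E3} {X : E3 → ℝ → E3} (hX : IsLagrangianMap v X)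
    (a : E3) (t : ℝ) (i : Fin 3) : HasDerivAt (fun s => X a s i) (v (X a t) i) t :=
  (EuclideanSpace.proj (𝕜 := ℝ) i).hasFDerivAt.comp_hasDerivAt t ((hX a).2 t)

lemma IsLagrangianMap.planarAB {X : E3 → ℝ → E3} (hX : IsLagrangianMap abFlow X) (a : E3) :
    PlanarAB (fun t => X a t 0) (fun t => X a t 1) :=
  ⟨fun t => hX.hasDerivAt_apply a t 0, fun t => hX.hasDerivAt_apply a t 1⟩

namespace PlanarAB

variable {x y : ℝ → ℝ}

/-- The addition formulas for cos (x ± y) turn the sums of products into single cosines; all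
complex-time estimates use this form. -/
lemma cosineSystem (h : PlanarAB x y) :
    CosineSystem (fun t => x t + y t) (fun t => x t - y t) := by
  refine ⟨fun t => ((h.fst t).fun_add (h.snd t)).congr_deriv ?_,
    fun t => ((h.fst t).fun_sub (h.snd t)).congr_deriv ?_⟩
  · rw [Real.cos_sub]; ring
  · rw [Real.cos_add]; ring

lemma sin_mul_cos_eq (h : PlanarAB x y) (t : ℝ) :
    Real.sin (x t) * Real.cos (y t) = Real.sin (x 0) * Real.cos (y 0) := by
  have hd : ∀ t, HasDerivAt (fun t => Real.sin (x t) * Real.cos (y t)) 0 t := fun t =>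
    ((h.fst t).sin.fun_mul (h.snd t).cos).congr_deriv (by ring)
  exact is_const_of_deriv_eq_zero (fun t => (hd t).differentiableAt) (fun t => (hd t).deriv) t 0

/-- Along a trajectory sin x solves a linear equation with coefficient -cos x sin y, so it vanishes
always or never. -/
lemma sin_eq_zero (h : PlanarAB x y) {t₀ : ℝ} (h0 : Real.sin (x t₀) = 0) (t : ℝ) :
    Real.sin (x t) = 0 :=
  eq_zero_of_linear_ode (y := fun t => Real.sin (x t))
    (g := fun t => -(Real.cos (x t) * Real.sin (y t))) (K := 1)
    (fun t => (h.fst t).sin.congr_deriv (by ring))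
    (fun t => by
      rw [abs_neg, abs_mul]
      exact mul_le_one₀ (Real.abs_cos_le_one _) (abs_nonneg _) (Real.abs_sin_le_one _)) h0 t

lemma fst_eq_of_sin_eq_zero (h : PlanarAB x y) (h0 : Real.sin (x 0) = 0) (t : ℝ) :
    x t = x 0 := by
  have hd : ∀ t, HasDerivAt x 0 t := fun t =>
    (h.fst t).congr_deriv (by rw [h.sin_eq_zero h0 t]; ring)
  exact is_const_of_deriv_eq_zero (fun t => (hd t).differentiableAt) (fun t => (hd t).deriv) t 0

lemma hasDerivAt_sin_sq (h : PlanarAB x y) (t : ℝ) : HasDerivAt (fun s => Real.sin (x s) ^ 2)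
    (-2 * (Real.sin (x t) ^ 2 * (Real.cos (x t) * Real.sin (y t)))) t :=
  ((h.fst t).sin.fun_pow 2).congr_deriv (by push_cast; ring)

/-- With w = sin² a and ψ = sin a cos b one has 1 - w = cos² a and w - ψ² = sin² a sin² b, so the
cubic is a perfect square. -/
lemma sqrt_cubic_eq (a b : ℝ) :
    √(Real.sin a ^ 2 * (1 - Real.sin a ^ 2) * (Real.sin a ^ 2 - (Real.sin a * Real.cos b) ^ 2)) =
      Real.sin a ^ 2 * |Real.cos a * Real.sin b| := by
  have : Real.sin a ^ 2 * (1 - Real.sin a ^ 2) * (Real.sin a ^ 2 - (Real.sin a * Real.cos b) ^ 2) =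
      (Real.sin a ^ 2 * (Real.cos a * Real.sin b)) ^ 2 := by
    rw [← Real.cos_sq', mul_pow, Real.cos_sq' b]
    ring
  rw [this, Real.sqrt_sq_eq_abs, abs_mul, abs_of_nonneg (sq_nonneg _)]

lemma hasDerivAt_sin_sq_sign (h : PlanarAB x y) (t : ℝ) :
    HasDerivAt (fun s => Real.sin (x s) ^ 2)
      (-2 * (SignType.sign (Real.cos (x t) * Real.sin (y t)) : ℝ) *
        √(Real.sin (x t) ^ 2 * (1 - Real.sin (x t) ^ 2) *
          (Real.sin (x t) ^ 2 - (Real.sin (x 0) * Real.cos (y 0)) ^ 2))) t := by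
  refine (h.hasDerivAt_sin_sq t).congr_deriv ?_
  rw [← h.sin_mul_cos_eq t, sqrt_cubic_eq]
  linear_combination (2 * Real.sin (x t) ^ 2) * sign_mul_abs (Real.cos (x t) * Real.sin (y t))

/-- Integration of the equation of `sin² x` by an elliptic integral. -/
lemma elliptic_integral (h : PlanarAB x y) {ε t₀ t₁ : ℝ} (hs : Real.sin (x 0) ≠ 0)
    (hε : ε = 1 ∨ ε = -1) (ht : t₀ < t₁)
    (hpos : ∀ s ∈ Set.Ioo t₀ t₁, 0 < ε * (Real.cos (x s) * Real.sin (y s))) :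
    IntervalIntegrable
      (fun w : ℝ => 1 / √(w * (1 - w) * (w - (Real.sin (x 0) * Real.cos (y 0)) ^ 2))) volume
      (Real.sin (x t₀) ^ 2) (Real.sin (x t₁) ^ 2) ∧
    ∫ w in (Real.sin (x t₀) ^ 2)..(Real.sin (x t₁) ^ 2),
      1 / √(w * (1 - w) * (w - (Real.sin (x 0) * Real.cos (y 0)) ^ 2)) = -2 * ε * (t₁ - t₀) := by
  set F : ℝ → ℝ := fun w =>
    1 / √(w * (1 - w) * (w - (Real.sin (x 0) * Real.cos (y 0)) ^ 2)) with hF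
  set w : ℝ → ℝ := fun t => Real.sin (x t) ^ 2 with hw
  set w' : ℝ → ℝ := fun t => -2 * (Real.sin (x t) ^ 2 * (Real.cos (x t) * Real.sin (y t))) with hw'
  have hne : ∀ t, Real.sin (x t) ≠ 0 := fun t h0 => hs (h.sin_eq_zero h0 0)
  have hder : ∀ t, HasDerivAt w (w' t) t := h.hasDerivAt_sin_sq
  have hcont : Continuous w := continuous_iff_continuousAt.2 fun t => (hder t).continuousAt
  have hsign : ∀ t ∈ Set.Ioo t₀ t₁, 0 < (-ε) * w' t := fun t ht => by
    have h1 := hpos t ht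
    have h2 : 0 < Real.sin (x t) ^ 2 := by have := hne t; positivity
    calc (0 : ℝ) < 2 * (Real.sin (x t) ^ 2 * (ε * (Real.cos (x t) * Real.sin (y t)))) := by
          positivity
      _ = (-ε) * w' t := by simp only [hw']; ring
  -- After the substitution w = w(t) the integrand is the constant 2. The original integrand may be
  -- singular at the end points, so the change of variables is made on the open interval, and
  -- integrability comes from the constant.
  have habs : ∀ t ∈ Set.Ioo t₀ t₁, |w' t| * F (w t) = 2 := fun t ht => by
    have h1 := hpos t ht
    have h2 : 0 < |Real.cos (x t) * Real.sin (y t)| :=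
      abs_pos.2 fun h0 => by rw [h0, mul_zero] at h1; exact lt_irrefl _ h1
    have h3 : 0 < Real.sin (x t) ^ 2 := by have := hne t; positivity
    simp only [hF, hw, hw']
    rw [← h.sin_mul_cos_eq t, sqrt_cubic_eq, abs_mul, abs_mul (Real.sin (x t) ^ 2),
      abs_of_pos h3, abs_neg, abs_two, mul_one_div, mul_div_cancel_right₀ _ (by positivity)]
  have hmono : StrictMonoOn (fun t => (-ε) * w t) (Set.Icc t₀ t₁) := by
    refine strictMonoOn_of_deriv_pos (convex_Icc _ _) (by fun_prop) fun t ht => ?_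
    rw [interior_Icc] at ht
    rw [((hder t).const_mul (-ε)).deriv]
    exact hsign t ht
  have hinj : Set.InjOn w (Set.Ioo t₀ t₁) := fun s hs t ht hst =>
    hmono.injOn (Set.Ioo_subset_Icc_self hs) (Set.Ioo_subset_Icc_self ht) (by simp [hst])
  have himage : w '' Set.Ioo t₀ t₁ = Set.Ioo (min (w t₀) (w t₁)) (max (w t₀) (w t₁)) := by
    have hl := Set.left_mem_Icc.2 ht.le
    have hr := Set.right_mem_Icc.2 ht.le
    rcases hε with rfl | rfl
    · have hanti : StrictAntiOn w (Set.Icc t₀ t₁) := fun s hs t ht hst => by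
        have := hmono hs ht hst
        simp only at this
        linarith
      have hlt := hanti hl hr ht
      rw [min_eq_right hlt.le, max_eq_left hlt.le]
      refine Set.Subset.antisymm ?_ (intermediate_value_Ioo' ht.le hcont.continuousOn)
      rintro _ ⟨s, hs, rfl⟩
      exact ⟨hanti (Set.Ioo_subset_Icc_self hs) hr hs.2, hanti hl (Set.Ioo_subset_Icc_self hs) hs.1⟩
    · have hmon : StrictMonoOn w (Set.Icc t₀ t₁) := fun s hs t ht hst => by
        have := hmono hs ht hst
        simp only at this
        linarith
      have hlt := hmon hl hr ht
      rw [min_eq_left hlt.le, max_eq_right hlt.le]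
      refine Set.Subset.antisymm ?_ (intermediate_value_Ioo ht.le hcont.continuousOn)
      rintro _ ⟨s, hs, rfl⟩
      exact ⟨hmon hl (Set.Ioo_subset_Icc_self hs) hs.1, hmon (Set.Ioo_subset_Icc_self hs) hr hs.2⟩
  have hdw : ∀ t ∈ Set.Ioo t₀ t₁, HasDerivWithinAt w (w' t) (Set.Ioo t₀ t₁) t :=
    fun t _ => (hder t).hasDerivWithinAt
  have hint : IntegrableOn F (Set.Ioo (min (w t₀) (w t₁)) (max (w t₀) (w t₁))) := by
    rw [← himage, integrableOn_image_iff_integrableOn_abs_deriv_smul measurableSet_Ioo hdw hinj]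
    refine (integrableOn_const (C := (2 : ℝ)) (by simp)).congr_fun (fun t ht => ?_)
      measurableSet_Ioo
    exact (habs t ht).symm
  have hval : ∫ u in Set.Ioo (min (w t₀) (w t₁)) (max (w t₀) (w t₁)), F u = 2 * (t₁ - t₀) := by
    rw [← himage, integral_image_eq_integral_abs_deriv_smul measurableSet_Ioo hdw hinj]
    refine (setIntegral_congr_fun measurableSet_Ioo (g := fun _ => (2 : ℝ)) habs).trans ?_
    simp [ht.le]
    ring
  have hval' : ∫ u in Set.Ioc (min (w t₀) (w t₁)) (max (w t₀) (w t₁)), F u = 2 * (t₁ - t₀) := by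
    rw [integral_Ioc_eq_integral_Ioo, hval]
  have hlt := hmono (Set.left_mem_Icc.2 ht.le) (Set.right_mem_Icc.2 ht.le) ht
  simp only at hlt
  constructor
  · rw [intervalIntegrable_iff, Set.uIoc]
    exact (integrableOn_Ioc_iff_integrableOn_Ioo (by simp)).2 hint
  · rw [intervalIntegral.intervalIntegral_eq_integral_uIoc, Set.uIoc, hval']
    rcases hε with rfl | rfl
    · rw [if_neg (by linarith)]; simp
    · rw [if_pos (by linarith)]; simp

/-- The trajectories in the planes `sin x = 0`. -/
lemma sin_snd_eq (h : PlanarAB x y) (h0 : Real.sin (x 0) = 0) (t : ℝ) :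
    Real.sin (y t) = (Real.sin (y 0) - Real.tanh (Real.cos (x 0) * t)) /
      (1 - Real.sin (y 0) * Real.tanh (Real.cos (x 0) * t)) := by
  set e := Real.cos (x 0)
  set σ := Real.sin (y 0) with hσ
  have hde : ∀ t : ℝ, HasDerivAt (fun t => e * t) e t := fun t => by
    simpa using (hasDerivAt_id t).const_mul e
  have hy : ∀ t, HasDerivAt y (-(e * Real.cos (y t))) t := fun t =>
    (h.snd t).congr_deriv (by rw [h.fst_eq_of_sin_eq_zero h0 t])
  -- The claimed formula with denominators cleared: the difference P of its two sides satisfies P' =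
  -- e sin(y) P and P(0) = 0.
  have hP := eq_zero_of_linear_ode (t₀ := 0) (K := 1)
    (y := fun t => Real.sin (y t) * (Real.cosh (e * t) - σ * Real.sinh (e * t)) -
      (σ * Real.cosh (e * t) - Real.sinh (e * t))) (g := fun t => e * Real.sin (y t))
    (fun t => (((hy t).sin.fun_mul ((hde t).cosh.fun_sub ((hde t).sinh.const_mul σ))).fun_sub
      (((hde t).cosh.const_mul σ).fun_sub (hde t).sinh)).congr_deriv (by
        linear_combination (-e * (Real.cosh (e * t) - σ * Real.sinh (e * t))) *
          Real.sin_sq_add_cos_sq (y t)))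
    (fun t => by
      rw [abs_mul]
      exact mul_le_one₀ (Real.abs_cos_le_one _) (abs_nonneg _) (Real.abs_sin_le_one _))
    (by simp [hσ]) t
  have hc : 0 < Real.cosh (e * t) := Real.cosh_pos _
  have hlt : |Real.sinh (e * t)| < Real.cosh (e * t) := by
    rw [Real.abs_sinh, ← Real.cosh_abs]; exact Real.sinh_lt_cosh _
  have hden : 0 < Real.cosh (e * t) - σ * Real.sinh (e * t) := by
    have h1 : |σ * Real.sinh (e * t)| ≤ |Real.sinh (e * t)| := by
      rw [abs_mul]
      exact mul_le_of_le_one_left (abs_nonneg _) (Real.abs_sin_le_one _)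
    linarith [le_abs_self (σ * Real.sinh (e * t))]
  rw [Real.tanh_eq_sinh_div_cosh]
  have hden' : 1 - σ * (Real.sinh (e * t) / Real.cosh (e * t)) =
      (Real.cosh (e * t) - σ * Real.sinh (e * t)) / Real.cosh (e * t) := by
    field_simp
  rw [hden', eq_div_iff (by positivity)]
  field_simp
  linarith

end PlanarAB

lemma IsLagrangianMap.abFlow_two_eq {X : E3 → ℝ → E3} (hX : IsLagrangianMap abFlow X) (a : E3)
    (t : ℝ) : X a t 2 = a 2 + √2 * abStream a * t := by
  have hψ : ∀ t, abStream (X a t) = abStream a := fun t => by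
    have := (hX.planarAB a).sin_mul_cos_eq t
    rw [(hX a).1] at this
    exact this
  have hd : ∀ t, HasDerivAt (fun t => X a t 2 - √2 * abStream a * t) 0 t := fun t =>
    ((hX.hasDerivAt_apply a t 2).fun_sub
      ((hasDerivAt_id t).const_mul (√2 * abStream a))).congr_deriv (by
        rw [← hψ t, abFlow_two, abStream]; ring)
  have := is_const_of_deriv_eq_zero (fun t => (hd t).differentiableAt) (fun t => (hd t).deriv) t 0
  simp only [(hX a).1, mul_zero, sub_zero] at this
  linarith

/-- Up to a factor ±i this is the elliptic integrand for ψ = 0, integrated from w = 1 to w = ∞; the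
primitive 2 arctan √(w - 1) runs from 0 to π. -/
lemma integral_one_div_mul_sqrt_sub_one :
    IntegrableOn (fun w : ℝ => 1 / (w * √(w - 1))) (Set.Ioi 1) ∧
      ∫ w in Set.Ioi (1 : ℝ), 1 / (w * √(w - 1)) = Real.pi := by
  have hd : ∀ w ∈ Set.Ioi (1 : ℝ),
      HasDerivAt (fun w => 2 * Real.arctan √(w - 1)) (1 / (w * √(w - 1))) w := fun w hw => by
    have hw1 : 0 < w - 1 := by simpa using hw
    have h1 := (((hasDerivAt_id w).sub_const 1).sqrt hw1.ne').arctan.const_mul 2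
    refine h1.congr_deriv ?_
    simp only [id]
    rw [Real.sq_sqrt hw1.le]
    have : 0 < √(w - 1) := Real.sqrt_pos.2 hw1
    have : 0 < w := by linarith
    field_simp
    ring
  have hc : ContinuousWithinAt (fun w => 2 * Real.arctan √(w - 1)) (Set.Ici 1) 1 :=
    Continuous.continuousWithinAt (by fun_prop)
  have hpos : ∀ w ∈ Set.Ioi (1 : ℝ), 0 ≤ 1 / (w * √(w - 1)) := fun w hw => by
    have : 0 < w := by have : 1 < w := hw; linarith
    positivity
  have hlim : Tendsto (fun w => 2 * Real.arctan √(w - 1)) atTop (𝓝 Real.pi) := by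
    have h1 : Tendsto (fun w : ℝ => √(w - 1)) atTop atTop :=
      Real.tendsto_sqrt_atTop.comp (tendsto_atTop_add_const_right _ (-1) tendsto_id)
    have h2 := ((Real.tendsto_arctan_atTop.mono_right nhdsWithin_le_nhds).comp h1).const_mul 2
    rwa [mul_div_cancel₀ _ two_ne_zero] at h2
  refine ⟨integrableOn_Ioi_deriv_of_nonneg hc hd hpos hlim, ?_⟩
  rw [integral_Ioi_of_hasDerivAt_of_nonneg hc hd hpos hlim]
  simp

/-! ### Radius exactly π/2 in the discs, and uniform Taylor bounds. -/

/-- The sum of the complexified Taylor series of `α` at `0`. -/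
noncomputable def taylorExtension (α : ℝ → ℝ) (z : ℂ) : ℂ :=
  ∑' n : ℕ, (n ! : ℂ)⁻¹ * ((iteratedDeriv n α 0 : ℝ) : ℂ) * z ^ n

/-- The Taylor series is one function for all radii, so the extensions to discs of radius r < π/2
unite on the open disc of radius π/2 without gluing. -/
lemma ExtendsToBall.taylorExtension {α : ℝ → ℝ} {A : ℂ → ℂ} {ρ : ℝ} (hρ : 0 < ρ)
    (hA : ExtendsToBall α A ρ) : ExtendsToBall α (taylorExtension α) ρ := by
  have heq : ∀ z ∈ Metric.ball (0 : ℂ) ρ, _root_.taylorExtension α z = A z := fun z hz => by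
    rw [← Complex.taylorSeries_eq_on_ball' hz hA.1, _root_.taylorExtension]
    refine tsum_congr fun n => ?_
    rw [hA.iteratedDeriv_eq hρ, sub_zero]
  have hball : ∀ᶠ t : ℝ in 𝓝 0, (t : ℂ) ∈ Metric.ball (0 : ℂ) ρ :=
    (Complex.continuous_ofReal.tendsto 0).eventually
      (by rw [Complex.ofReal_zero]; exact Metric.ball_mem_nhds _ hρ)
  refine ⟨hA.1.congr heq, ?_⟩
  filter_upwards [hA.2, hball] with t ht hb
  rw [heq _ hb, ht]

/-- Every translate of `f` extends holomorphically to the disc of radius `π / 2`. -/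
def HalfPiAnalytic (f : ℝ → ℝ) : Prop :=
  ∀ t₀, ∃ A, ExtendsToBall (fun t => f (t₀ + t)) A (Real.pi / 2)

lemma CosineSystem.extendsToBall_half_pi {α β : ℝ → ℝ} (h : CosineSystem α β) :
    ExtendsToBall α (taylorExtension α) (Real.pi / 2) ∧
      ExtendsToBall β (taylorExtension β) (Real.pi / 2) := by
  have key : ∀ r, 0 < r → r < Real.pi / 2 → ExtendsToBall α (taylorExtension α) r ∧
      ExtendsToBall β (taylorExtension β) r := fun r hr0 hr => by
    obtain ⟨A, B, hA, hB⟩ := h.exists_extension hr0 hr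
    exact ⟨hA.taylorExtension hr0, hB.taylorExtension hr0⟩
  have h1 := key 1 one_pos (by linarith [Real.pi_gt_three])
  have hd : ∀ z ∈ Metric.ball (0 : ℂ) (Real.pi / 2), DifferentiableAt ℂ (taylorExtension α) z ∧
      DifferentiableAt ℂ (taylorExtension β) z := fun z hz => by
    obtain ⟨r, hzr, hr⟩ := exists_between (show ‖z‖ < Real.pi / 2 by simpa using hz)
    obtain ⟨h2, h3⟩ := key r ((norm_nonneg z).trans_lt hzr) hr
    have hn : Metric.ball (0 : ℂ) r ∈ 𝓝 z := Metric.isOpen_ball.mem_nhds (by simpa using hzr)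
    exact ⟨h2.1.differentiableAt hn, h3.1.differentiableAt hn⟩
  exact ⟨⟨fun z hz => (hd z hz).1.differentiableWithinAt, h1.1.2⟩,
    ⟨fun z hz => (hd z hz).2.differentiableWithinAt, h1.2.2⟩⟩

lemma CosineSystem.halfPiAnalytic {α β : ℝ → ℝ} (h : CosineSystem α β) :
    HalfPiAnalytic α ∧ HalfPiAnalytic β :=
  ⟨fun t₀ => ⟨_, (h.translate t₀).extendsToBall_half_pi.1⟩,
    fun t₀ => ⟨_, (h.translate t₀).extendsToBall_half_pi.2⟩⟩

namespace HalfPiAnalytic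

variable {f g : ℝ → ℝ}

lemma linear_comb (hf : HalfPiAnalytic f) (hg : HalfPiAnalytic g) (a b : ℝ) :
    HalfPiAnalytic (fun t => a * f t + b * g t) := by
  intro t₀
  obtain ⟨A, hA⟩ := hf t₀
  obtain ⟨B, hB⟩ := hg t₀
  refine ⟨fun z => a * A z + b * B z, (hA.1.const_mul _).fun_add (hB.1.const_mul _), ?_⟩
  filter_upwards [hA.2, hB.2] with t h1 h2
  rw [h1, h2]; push_cast; rfl

lemma affine (a b : ℝ) : HalfPiAnalytic (fun t => a + b * t) := fun t₀ =>
  ⟨fun z => a + b * (t₀ + z), by fun_prop, .of_forall fun t => by push_cast; rfl⟩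

lemma sub_const (hf : HalfPiAnalytic f) (c : ℝ) : HalfPiAnalytic (fun t => f t - c) := by
  have := hf.linear_comb (affine c 0) 1 (-1)
  simpa [sub_eq_add_neg] using this

lemma exists_strip (hf : HalfPiAnalytic f) : ∃ F : ℂ → ℂ,
    DifferentiableOn ℂ F {z | |z.im| < Real.pi / 2} ∧ ∀ t : ℝ, F t = f t :=
  exists_extension_strip Real.pi_div_two_pos hf

lemma hasSum (hf : HalfPiAnalytic f) {t : ℝ} (ht : |t| < Real.pi / 2) :
    HasSum (fun n : ℕ => t ^ n * ((n ! : ℝ)⁻¹ * iteratedDeriv n f 0)) (f t) := by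
  obtain ⟨A, hA⟩ := hf 0
  simp only [zero_add] at hA
  have h1 := Complex.hasSum_taylorSeries_on_ball hA.1 (z := (t : ℂ)) (by simpa using ht)
  rw [hA.eq_ofReal Real.pi_div_two_pos hf ht] at h1
  rw [← Complex.hasSum_ofReal]
  refine h1.congr_fun fun n => ?_
  rw [hA.iteratedDeriv_eq Real.pi_div_two_pos]
  simp only [sub_zero, smul_eq_mul]
  push_cast; ring

end HalfPiAnalytic

/-- The Taylor coefficients of solutions are bounded geometrically, uniformly in the solution. -/
lemma CosineSystem.exists_iteratedDeriv_le {r : ℝ} (hr0 : 0 < r) (hr : r < Real.pi / 2) :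
    ∃ C, ∀ α β : ℝ → ℝ, CosineSystem α β → ∀ n : ℕ,
      |iteratedDeriv (n + 1) α 0| / (n + 1)! * r ^ (n + 1) ≤ C ∧
        |iteratedDeriv (n + 1) β 0| / (n + 1)! * r ^ (n + 1) ≤ C := by
  obtain ⟨C, hC⟩ := exists_extension_coeff_le hr0 hr
  refine ⟨C, fun α β h n => ?_⟩
  obtain ⟨A, B, hA, hB, hAB⟩ := hC α β h
  have := hAB n
  rwa [hA.iteratedDeriv_eq hr0, hB.iteratedDeriv_eq hr0, Complex.norm_real, Complex.norm_real]
    at this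

lemma iteratedDeriv_E3_apply {f : ℝ → E3} {n : ℕ} (hf : ContDiff ℝ n f) (t : ℝ) (i : Fin 3) :
    iteratedDeriv n f t i = iteratedDeriv n (fun s => f s i) t := by
  have := (EuclideanSpace.proj i : E3 →L[ℝ] ℝ).iteratedFDeriv_comp_left
    (hf.contDiffAt (x := t)) le_rfl
  rw [iteratedDeriv_eq_iteratedFDeriv, iteratedDeriv_eq_iteratedFDeriv]
  exact (congrArg (fun m => m fun _ => 1) this).symm

namespace IsLagrangianMap

variable {X : E3 → ℝ → E3}

lemma halfPiAnalytic (hX : IsLagrangianMap abFlow X) (a : E3) (i : Fin 3) :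
    HalfPiAnalytic (fun t => X a t i) := by
  obtain ⟨h1, h2⟩ := (hX.planarAB a).cosineSystem.halfPiAnalytic
  fin_cases i
  · convert h1.linear_comb h2 (1 / 2) (1 / 2) using 2 with t
    simp; ring
  · convert h1.linear_comb h2 (1 / 2) (-1 / 2) using 2 with t
    simp; ring
  · convert HalfPiAnalytic.affine (a 2) (√2 * abStream a) using 2 with t
    exact hX.abFlow_two_eq a t

lemma contDiff (hX : IsLagrangianMap abFlow X) (a : E3) (n : ℕ) : ContDiff ℝ n (X a) := by
  obtain ⟨h1, h2⟩ := (hX.planarAB a).cosineSystem.contDiff n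
  rw [contDiff_euclidean]
  intro i
  fin_cases i
  · have := (h1.add h2).mul (contDiff_const (c := (1 / 2 : ℝ)))
    refine (funext fun t => ?_ : (fun t => X a t 0) = _) ▸ this
    ring
  · have := (h1.sub h2).mul (contDiff_const (c := (1 / 2 : ℝ)))
    refine (funext fun t => ?_ : (fun t => X a t 1) = _) ▸ this
    ring
  · have : (fun t => X a t 2) = fun t => a 2 + √2 * abStream a * t := funext (hX.abFlow_two_eq a)
    change ContDiff ℝ n (fun t => X a t 2)
    rw [this]
    fun_prop

lemma taylorCoeff_apply (hX : IsLagrangianMap abFlow X) (a : E3) (s : ℕ) (i : Fin 3) :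
    taylorCoeff X a s i = (s ! : ℝ)⁻¹ * iteratedDeriv s (fun t => X a t i - a i) 0 := by
  rw [taylorCoeff, PiLp.smul_apply, iteratedDeriv_E3_apply ((hX.contDiff a s).sub contDiff_const)]
  rfl

lemma hasSum_taylorCoeff (hX : IsLagrangianMap abFlow X) (a : E3) {t : ℝ}
    (ht : |t| < Real.pi / 2) :
    HasSum (fun s : ℕ => t ^ s • taylorCoeff X a s) (X a t - a) := by
  rw [← (EuclideanSpace.equiv (Fin 3) ℝ).hasSum', Pi.hasSum]
  intro i
  have := ((hX.halfPiAnalytic a i).sub_const (a i)).hasSum ht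
  refine this.congr_fun fun s => ?_
  simp [hX.taylorCoeff_apply]

/-- Geometric bounds of the Taylor coefficients, uniformly over all particles. -/
lemma exists_taylorCoeff_le (hX : IsLagrangianMap abFlow X) {r : ℝ} (hr0 : 0 < r)
    (hr : r < Real.pi / 2) : ∃ C, ∀ s a, ‖taylorCoeff X a s‖ * r ^ s ≤ C := by
  obtain ⟨C, hC⟩ := CosineSystem.exists_iteratedDeriv_le hr0 hr
  have hC0 : 0 ≤ C :=
    le_trans (by positivity) (hC _ _ (hX.planarAB 0).cosineSystem 0).1
  -- Each horizontal component contributes C. The vertical displacement √2 ψ t has only the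
  -- coefficient s = 1, and |ψ| ≤ 1.
  refine ⟨2 * C + √2 * r, fun s a => ?_⟩
  cases s with
  | zero =>
    have : taylorCoeff X a 0 = 0 := by simp [taylorCoeff, (hX a).1]
    rw [this]
    simp; positivity
  | succ n =>
    have hcs := (hX.planarAB a).cosineSystem
    obtain ⟨h1, h2⟩ := hC _ _ hcs n
    obtain ⟨d1, d2⟩ := hcs.contDiff (n + 1)
    -- Both horizontal coordinates are (α + εβ)/2 with ε = ±1; the initial position c drops out in
    -- positive order.
    have half : ∀ ε c : ℝ, |ε| = 1 →
        |iteratedDeriv (n + 1) (fun t => -c + (1 / 2) * ((X a t 0 + X a t 1) +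
          ε * (X a t 0 - X a t 1))) 0| / (n + 1)! * r ^ (n + 1) ≤ C := fun ε c hε => by
      rw [iteratedDeriv_const_add (Nat.succ_pos n), iteratedDeriv_const_mul_field,
        iteratedDeriv_fun_add d1.contDiffAt (contDiffAt_const.mul d2.contDiffAt),
        iteratedDeriv_const_mul_field]
      rw [abs_mul, div_mul_eq_mul_div, div_le_iff₀ (by positivity)]
      rw [div_mul_eq_mul_div, div_le_iff₀ (by positivity)] at h1 h2
      have hrp : (0 : ℝ) < r ^ (n + 1) := by positivity
      have h3 := abs_add_le (iteratedDeriv (n + 1) (fun t => X a t 0 + X a t 1) 0)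
        (ε * iteratedDeriv (n + 1) (fun t => X a t 0 - X a t 1) 0)
      rw [abs_mul ε, hε, one_mul] at h3
      have h4 := mul_le_mul_of_nonneg_right h3 hrp.le
      rw [abs_of_pos (by norm_num : (0 : ℝ) < 1 / 2)]
      linarith
    have e0 : |taylorCoeff X a (n + 1) 0| * r ^ (n + 1) ≤ C := by
      have : (fun t => X a t 0 - a 0) = fun t => -a 0 + (1 / 2) * ((X a t 0 + X a t 1) +
          1 * (X a t 0 - X a t 1)) := by funext t; ring
      rw [hX.taylorCoeff_apply, abs_mul, abs_inv, Nat.abs_cast, inv_mul_eq_div, this]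
      exact half 1 _ abs_one
    have e1 : |taylorCoeff X a (n + 1) 1| * r ^ (n + 1) ≤ C := by
      have : (fun t => X a t 1 - a 1) = fun t => -a 1 + (1 / 2) * ((X a t 0 + X a t 1) +
          -1 * (X a t 0 - X a t 1)) := by funext t; ring
      rw [hX.taylorCoeff_apply, abs_mul, abs_inv, Nat.abs_cast, inv_mul_eq_div, this]
      exact half (-1) _ (by simp)
    have e2 : |taylorCoeff X a (n + 1) 2| * r ^ (n + 1) ≤ √2 * r := by
      have : (fun t => X a t 2 - a 2) = fun t => √2 * abStream a * t := by
        funext t; rw [hX.abFlow_two_eq a t]; ring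
      rw [hX.taylorCoeff_apply, this, iteratedDeriv_const_mul_field, iteratedDeriv_fun_id_zero]
      rcases Nat.eq_zero_or_pos n with rfl | hn
      · have hψ : |abStream a| ≤ 1 := by
          rw [abStream, abs_mul]
          exact mul_le_one₀ (Real.abs_sin_le_one _) (abs_nonneg _) (Real.abs_cos_le_one _)
        simp only [zero_add, Nat.factorial_one, Nat.cast_one, inv_one, one_mul, if_true, mul_one,
          pow_one, abs_mul, abs_of_nonneg (Real.sqrt_nonneg 2)]
        gcongr
        exact mul_le_of_le_one_right (Real.sqrt_nonneg 2) hψ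
      · rw [if_neg (by omega)]
        simp; positivity
    calc ‖taylorCoeff X a (n + 1)‖ * r ^ (n + 1)
        ≤ (|taylorCoeff X a (n + 1) 0| + |taylorCoeff X a (n + 1) 1| +
          |taylorCoeff X a (n + 1) 2|) * r ^ (n + 1) := by
          gcongr; exact E3.norm_le_sum_abs _
      _ ≤ 2 * C + √2 * r := by linarith

end IsLagrangianMap

/-! ### Complex-time singularities and radii of convergence. -/

lemma ContinuesTo.mono {x : ℝ → E3} {A B : Set ℂ} (h : ContinuesTo x B) (hAB : A ⊆ B) :
    ContinuesTo x A := by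
  obtain ⟨U, f, hU, hBU, hf⟩ := h
  exact ⟨U, f, hU, hAB.trans hBU, hf⟩

/-- Three coordinate functions holomorphic on an open set give an analytic continuation. -/
lemma ContinuesTo.of_coordinates {x : ℝ → E3} {U : Set ℂ} (hU : IsOpen U)
    (h : ∀ i : Fin 3, ∃ F : ℂ → ℂ, DifferentiableOn ℂ F U ∧
      ∀ᶠ t : ℝ in 𝓝 0, F t = ((x t i : ℝ) : ℂ)) : ContinuesTo x U := by
  choose F hF hFx using h
  refine ⟨U, fun z => WithLp.toLp 2 fun i => F i z, hU, subset_rfl, ?_, ?_⟩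
  · exact (differentiableOn_euclidean.2 hF).analyticOnNhd hU
  · rw [Filter.eventually_all]
    exact hFx

namespace IsLagrangianMap

variable {X : E3 → ℝ → E3}

lemma continuesTo_strip (hX : IsLagrangianMap abFlow X) (a : E3) :
    ContinuesTo (X a) {z | |z.im| < Real.pi / 2} := by
  refine ContinuesTo.of_coordinates (isOpen_lt (by fun_prop) continuous_const) fun i => ?_
  obtain ⟨F, hF, hFx⟩ := (hX.halfPiAnalytic a i).exists_strip
  exact ⟨F, hF, .of_forall hFx⟩

/-- The segment to a point of the strip stays in the strip. Bounding the imaginary part, not just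
the modulus, is what decides the equality case |τ| = π/2. -/
lemma half_pi_le_abs_im (hX : IsLagrangianMap abFlow X) {a : E3} {τ : ℂ}
    (hτ : IsComplexTimeSingularity (X a) τ) : Real.pi / 2 ≤ |τ.im| := by
  by_contra! hlt
  refine hτ.2 ((hX.continuesTo_strip a).mono ?_)
  rintro _ ⟨s, hs, rfl⟩
  simp only [Set.mem_ofPred_eq, Complex.im_ofReal_mul, abs_mul, abs_of_nonneg hs.1]
  exact (mul_le_of_le_one_left (abs_nonneg _) hs.2).trans_lt hlt

lemma complexTimeSingularity_bound (hX : IsLagrangianMap abFlow X) {a : E3} {τ : ℂ}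
    (hτ : IsComplexTimeSingularity (X a) τ) : Real.pi / 2 ≤ ‖τ‖ ∧
      (‖τ‖ = Real.pi / 2 → τ = Complex.I * Real.pi / 2 ∨ τ = -(Complex.I * Real.pi / 2)) := by
  have him := hX.half_pi_le_abs_im hτ
  refine ⟨him.trans (Complex.abs_im_le_norm τ), fun h => ?_⟩
  have him' : |τ.im| = Real.pi / 2 := le_antisymm (h ▸ Complex.abs_im_le_norm τ) him
  have hre : τ.re = 0 := by
    have h1 : τ.re * τ.re + τ.im * τ.im = ‖τ‖ ^ 2 := by
      rw [← Complex.normSq_apply, Complex.normSq_eq_norm_sq]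
    have h2 : τ.im * τ.im = (Real.pi / 2) ^ 2 := by rw [← abs_mul_abs_self, him', sq]
    rw [h, h2] at h1
    nlinarith
  have hval : τ = τ.im * Complex.I := by
    apply Complex.ext <;> simp [hre]
  rcases (abs_eq Real.pi_div_two_pos.le).1 him' with h1 | h1
  · left; rw [hval, h1]; push_cast; ring
  · right; rw [hval, h1]; push_cast; ring

/-- If the Taylor coefficients of a particle are bounded geometrically, its trajectory continues to
the corresponding disc. -/
lemma continuesTo_ball (hX : IsLagrangianMap abFlow X) {a : E3} {r C : ℝ}
    (hC : ∀ s, ‖taylorCoeff X a s‖ * r ^ s ≤ C) (hr : 0 < r) :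
    ContinuesTo (X a) (Metric.ball 0 r) := by
  refine ContinuesTo.of_coordinates Metric.isOpen_ball fun i => ?_
  have hc : ∀ s, ‖((taylorCoeff X a s i : ℝ) : ℂ)‖ * r ^ s ≤ C := fun s => by
    rw [Complex.norm_real]
    exact (mul_le_mul_of_nonneg_right (E3.abs_apply_le_norm _ i) (by positivity)).trans (hC s)
  refine ⟨_, (differentiableOn_tsum_pow hc).1.const_add ((a i : ℝ) : ℂ), ?_⟩
  have he : ∀ᶠ t : ℝ in 𝓝 0, |t| < Real.pi / 2 :=
    (continuous_abs.tendsto (0 : ℝ)).eventually (gt_mem_nhds (by simpa using Real.pi_div_two_pos))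
  filter_upwards [he] with t ht
  have h1 := ((hX.halfPiAnalytic a i).sub_const (a i)).hasSum ht
  have h2 : HasSum (fun s : ℕ => (t : ℂ) ^ s * ((taylorCoeff X a s i : ℝ) : ℂ))
      ((X a t i - a i : ℝ) : ℂ) := by
    refine (Complex.hasSum_ofReal.2 h1).congr_fun fun s => ?_
    rw [hX.taylorCoeff_apply]
    push_cast; rfl
  rw [h2.tsum_eq]
  push_cast; ring

/-- The velocity of the particles with `ψ = 0` and `sin² x₁ = 1`. -/
lemma exists_hasDerivAt_div_cosh (hX : IsLagrangianMap abFlow X) {a : E3} (hψ : abStream a = 0)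
    (hs : Real.sin (a 0) ^ 2 = 1) :
    ∃ k ≠ 0, ∀ t, HasDerivAt (fun t => X a t 0) (k / Real.cosh t) t := by
  have h := hX.planarAB a
  set x := fun t => X a t 0 with hx
  set y := fun t => X a t 1 with hy
  have hx0 : x 0 = a 0 := by simp [hx, (hX a).1]
  have hy0 : y 0 = a 1 := by simp [hy, (hX a).1]
  have hsin : Real.sin (a 0) ≠ 0 := fun h0 => by rw [h0] at hs; norm_num at hs
  have hcx : Real.cos (a 0) = 0 := by
    have := Real.sin_sq_add_cos_sq (a 0); nlinarith
  have hcy : Real.cos (a 1) = 0 := (mul_eq_zero.1 hψ).resolve_left hsin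
  have habs : ∀ u v : ℝ, |u| ≤ 1 → |v| ≤ 1 → |u * v| ≤ 1 := fun u v hu hv => by
    rw [abs_mul]; exact mul_le_one₀ hu (abs_nonneg _) hv
  -- cos y solves a linear equation and starts at 0; hence y' = 0, and only a scalar equation for x
  -- remains.
  have hcyt : ∀ t, Real.cos (y t) = 0 := eq_zero_of_linear_ode (K := 1) (t₀ := 0)
    (y := fun t => Real.cos (y t)) (g := fun t => Real.sin (y t) * Real.cos (x t))
    (fun t => (h.snd t).cos.congr_deriv (by ring))
    (fun t => habs _ _ (Real.abs_sin_le_one _) (Real.abs_cos_le_one _)) (by rw [hy0, hcy])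
  have hyt : ∀ t, y t = a 1 := fun t => by
    have hd : ∀ t, HasDerivAt y 0 t := fun t => (h.snd t).congr_deriv (by rw [hcyt t]; ring)
    rw [← hy0]
    exact is_const_of_deriv_eq_zero (fun t => (hd t).differentiableAt) (fun t => (hd t).deriv) t 0
  set e := Real.sin (a 1)
  have he : e ^ 2 = 1 := by
    have := Real.sin_sq_add_cos_sq (a 1); rw [hcy] at this; linarith
  have hxd : ∀ t, HasDerivAt x (-(Real.sin (x t) * e)) t := fun t => by
    have := h.fst t
    rwa [hyt t] at this
  -- That is, e cos x = tanh t, multiplied out so that uniqueness for a linear equation applies. It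
  -- makes sin x · cosh t a constant of motion.
  have hQ : ∀ t, Real.sinh t - e * Real.cos (x t) * Real.cosh t = 0 :=
    eq_zero_of_linear_ode (K := 1) (t₀ := 0)
      (y := fun t => Real.sinh t - e * Real.cos (x t) * Real.cosh t)
      (g := fun t => -(e * Real.cos (x t)))
      (fun t => ((Real.hasDerivAt_sinh t).fun_sub
        (((hxd t).cos.const_mul e).fun_mul (Real.hasDerivAt_cosh t))).congr_deriv (by
          have h1 := Real.sin_sq_add_cos_sq (x t)
          linear_combination (-Real.cosh t * e ^ 2) * h1 + (-Real.cosh t) * he))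
      (fun t => by
        rw [abs_neg]; exact habs _ _ (Real.abs_sin_le_one _) (Real.abs_cos_le_one _))
      (by simp [hx0, hcx])
  have hconst : ∀ t, Real.sin (x t) * Real.cosh t = Real.sin (a 0) := fun t => by
    have hd : ∀ t, HasDerivAt (fun t => Real.sin (x t) * Real.cosh t) 0 t := fun t =>
      ((hxd t).sin.fun_mul (Real.hasDerivAt_cosh t)).congr_deriv (by
        linear_combination (Real.sin (x t)) * hQ t)
    have := is_const_of_deriv_eq_zero (fun t => (hd t).differentiableAt) (fun t => (hd t).deriv) t 0
    simpa [hx0] using this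
  refine ⟨-(Real.sin (a 0) * e), ?_, fun t => (hxd t).congr_deriv ?_⟩
  · exact neg_ne_zero.2 (mul_ne_zero hsin fun h0 => by rw [h0] at he; norm_num at he)
  · have := (Real.cosh_pos t).ne'
    rw [← hconst t]
    field_simp

/-- On a continuation, x₁'(z) cosh z = k persists along the segment by the identity theorem; at iπ/2
the left side is 0, while k ≠ 0. -/
lemma not_continuesTo_half_pi (hX : IsLagrangianMap abFlow X) {a : E3} (hψ : abStream a = 0)
    (hs : Real.sin (a 0) ^ 2 = 1) : ¬ ContinuesTo (X a)
      ((fun s : ℝ => (s : ℂ) * (Complex.I * Real.pi / 2)) '' Set.Icc 0 1) := by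
  rintro ⟨U, f, hU, hAU, hf, hfX⟩
  obtain ⟨k, hk, hder⟩ := hX.exists_hasDerivAt_div_cosh hψ hs
  set V := (fun s : ℝ => (s : ℂ) * (Complex.I * Real.pi / 2)) '' Set.Icc 0 1
  have hV : IsPreconnected V := isPreconnected_Icc.image _ (by fun_prop)
  have h0 : ((0 : ℝ) : ℂ) ∈ V := ⟨0, by simp, by simp⟩
  have h1 : Complex.I * Real.pi / 2 ∈ V := ⟨1, by simp, by simp⟩
  have hg : AnalyticOnNhd ℂ (fun z => f z 0) U := fun z hz =>
    ((EuclideanSpace.proj 0 : EuclideanSpace ℂ (Fin 3) →L[ℂ] ℂ).analyticAt _).comp (hf z hz)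
  have hG : AnalyticOnNhd ℂ (fun z => deriv (fun z => f z 0) z * Complex.cosh z) V := fun z hz =>
    (hg.deriv z (hAU hz)).fun_mul
      (Complex.differentiable_cosh.differentiableOn.analyticOnNhd isOpen_univ z trivial)
  have hUr : ∀ᶠ t : ℝ in 𝓝 0, (t : ℂ) ∈ U :=
    (Complex.continuous_ofReal.tendsto 0).eventually (hU.mem_nhds (hAU h0))
  have hfX0 : ∀ᶠ t : ℝ in 𝓝 0, f t 0 = ((X a t 0 : ℝ) : ℂ) := hfX.mono fun t ht => ht 0
  have heq := eqOn_of_real_eventuallyEq hG (G := fun _ => (k : ℂ)) (fun _ _ => analyticAt_const) hV h0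
    (by
      filter_upwards [hUr, hfX0.eventually_nhds] with t ht h2
      obtain ⟨h3, h4⟩ := (hg _ ht).differentiableAt.hasDerivAt.real_of_eventuallyEq_ofReal h2
      have hc : (Real.cosh t : ℂ) ≠ 0 := by exact_mod_cast (Real.cosh_pos t).ne'
      rw [h4, h3.unique (hder t), ← Complex.ofReal_cosh]
      push_cast
      rw [Complex.ofReal_cosh] at hc
      field_simp)
  have hz := heq h1
  have hcosh : Complex.cosh (Complex.I * Real.pi / 2) = 0 := by
    rw [mul_div_assoc, mul_comm, Complex.cosh_mul_I]
    exact Complex.cos_pi_div_two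
  simp only [hcosh, mul_zero] at hz
  exact hk (Complex.ofReal_eq_zero.1 hz.symm)

lemma isComplexTimeSingularity_half_pi (hX : IsLagrangianMap abFlow X) {a : E3}
    (hψ : abStream a = 0) (hs : Real.sin (a 0) ^ 2 = 1) :
    IsComplexTimeSingularity (X a) (Complex.I * Real.pi / 2) := by
  refine ⟨(hX.continuesTo_strip a).mono ?_, hX.not_continuesTo_half_pi hψ hs⟩
  rintro _ ⟨s, hs, rfl⟩
  have : (Complex.I * Real.pi / 2).im = Real.pi / 2 := by
    rw [mul_div_assoc, mul_comm]
    simp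
  simp only [Set.mem_ofPred_eq, Complex.im_ofReal_mul, abs_mul, abs_of_nonneg hs.1, this,
    abs_of_pos Real.pi_div_two_pos]
  exact mul_lt_of_lt_one_left Real.pi_div_two_pos hs.2

/-- A geometric bound with r > π/2 would continue the trajectory to a disc containing iπ/2. One such
particle thus bounds both the pointwise and the uniform radius from above. -/
lemma le_half_pi_of_taylorCoeff_le (hX : IsLagrangianMap abFlow X) {a : E3}
    (hψ : abStream a = 0) (hs : Real.sin (a 0) ^ 2 = 1) {r C : ℝ}
    (hC : ∀ s, ‖taylorCoeff X a s‖ * r ^ s ≤ C) : r ≤ Real.pi / 2 := by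
  by_contra! hlt
  refine hX.not_continuesTo_half_pi hψ hs
    ((hX.continuesTo_ball hC (Real.pi_div_two_pos.trans hlt)).mono ?_)
  rintro _ ⟨s, hs, rfl⟩
  have : ‖(Complex.I * Real.pi / 2)‖ = Real.pi / 2 := by
    simp [abs_of_pos Real.pi_pos]
  rw [mem_ball_zero_iff, norm_mul, this, Complex.norm_real, Real.norm_eq_abs, abs_of_nonneg hs.1]
  exact (mul_le_of_le_one_left Real.pi_div_two_pos.le hs.2).trans_lt hlt

lemma norm_taylorSeries (X : E3 → ℝ → E3) (a : E3) (s : ℕ) :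
    ‖taylorSeries X a s‖ = ‖taylorCoeff X a s‖ :=
  ContinuousMultilinearMap.norm_mkPiRing _

lemma half_pi_le_radius (hX : IsLagrangianMap abFlow X) (a : E3) :
    ENNReal.ofReal (Real.pi / 2) ≤ (taylorSeries X a).radius := by
  refine ENNReal.le_of_forall_nnreal_lt fun r hr => ?_
  rcases eq_or_ne r 0 with rfl | hr0
  · simp
  have hr' : (r : ℝ) < Real.pi / 2 := by
    rwa [ENNReal.lt_ofReal_iff_toReal_lt ENNReal.coe_ne_top, ENNReal.coe_toReal] at hr
  obtain ⟨C, hC⟩ := hX.exists_taylorCoeff_le (r := r) (by positivity) hr'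
  exact FormalMultilinearSeries.le_radius_of_bound _ C fun s => by
    rw [norm_taylorSeries]; exact hC s a

lemma radius_eq_half_pi (hX : IsLagrangianMap abFlow X) {a : E3} (hψ : abStream a = 0)
    (hs : Real.sin (a 0) ^ 2 = 1) :
    (taylorSeries X a).radius = ENNReal.ofReal (Real.pi / 2) := by
  refine le_antisymm (ENNReal.le_of_forall_nnreal_lt fun r hr => ?_) (hX.half_pi_le_radius a)
  obtain ⟨C, -, hC⟩ := (taylorSeries X a).norm_mul_pow_le_of_lt_radius hr
  simp only [norm_taylorSeries] at hC
  rw [← ENNReal.ofReal_coe_nnreal]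
  exact ENNReal.ofReal_le_ofReal (hX.le_half_pi_of_taylorCoeff_le hψ hs hC)

lemma uniformLagrangianRadius_eq (hX : IsLagrangianMap abFlow X) {a : E3} (hψ : abStream a = 0)
    (hs : Real.sin (a 0) ^ 2 = 1) :
    uniformLagrangianRadius X = ENNReal.ofReal (Real.pi / 2) := by
  refine le_antisymm (iSup₂_le fun r ⟨C, hC⟩ => ?_) (ENNReal.le_of_forall_nnreal_lt fun r hr => ?_)
  · rw [← ENNReal.ofReal_coe_nnreal]
    exact ENNReal.ofReal_le_ofReal (hX.le_half_pi_of_taylorCoeff_le hψ hs fun s => hC s a)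
  · rcases eq_or_ne r 0 with rfl | hr0
    · simp
    have hr' : (r : ℝ) < Real.pi / 2 := by
      rwa [ENNReal.lt_ofReal_iff_toReal_lt ENNReal.coe_ne_top, ENNReal.coe_toReal] at hr
    obtain ⟨C, hC⟩ := hX.exists_taylorCoeff_le (r := r) (by positivity) hr'
    exact le_iSup₂_of_le r ⟨C, hC⟩ le_rfl

end IsLagrangianMap

theorem mainTheorem5 :
    -- the AB flow is a steady Beltrami solution of the Euler equations
    IsSteadyEuler abFlow ∧ (∀ x, curl abFlow x = √2 • abFlow x) ∧
    -- its Lagrangian map exists for all real times and is unique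
    (∃! X : E3 → ℝ → E3, IsLagrangianMap abFlow X) ∧
    ∀ X : E3 → ℝ → E3, IsLagrangianMap abFlow X →
      -- the stream function is a Lagrangian invariant; the vertical motion is uniform
      (∀ a t, abStream (X a t) = abStream a) ∧
      (∀ a t, X a t 2 = a 2 + √2 * abStream a * t) ∧
      -- the separable equation for `w = sin² x₁`
      (∀ a t, HasDerivAt (fun s => Real.sin (X a s 0) ^ 2)
        (-2 * (SignType.sign (Real.cos (X a t 0) * Real.sin (X a t 1)) : ℝ) *
          √(Real.sin (X a t 0) ^ 2 * (1 - Real.sin (X a t 0) ^ 2) *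
            (Real.sin (X a t 0) ^ 2 - abStream a ^ 2))) t) ∧
      -- its solution by an elliptic integral on each interval of monotonicity of `w`
      (∀ (a : E3) (ε t₀ t₁ : ℝ), Real.sin (a 0) ≠ 0 → (ε = 1 ∨ ε = -1) → t₀ < t₁ →
        (∀ s ∈ Set.Ioo t₀ t₁, 0 < ε * (Real.cos (X a s 0) * Real.sin (X a s 1))) →
        IntervalIntegrable (fun w : ℝ => 1 / √(w * (1 - w) * (w - abStream a ^ 2))) volume
          (Real.sin (X a t₀ 0) ^ 2) (Real.sin (X a t₁ 0) ^ 2) ∧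
        ∫ w in (Real.sin (X a t₀ 0) ^ 2)..(Real.sin (X a t₁ 0) ^ 2),
          1 / √(w * (1 - w) * (w - abStream a ^ 2)) = -2 * ε * (t₁ - t₀)) ∧
      -- the remaining trajectories, on which `w` vanishes identically
      (∀ a t, Real.sin (a 0) = 0 → X a t 0 = a 0 ∧
        Real.sin (X a t 1) = (Real.sin (a 1) - Real.tanh (Real.cos (a 0) * t)) /
          (1 - Real.sin (a 1) * Real.tanh (Real.cos (a 0) * t))) ∧
      -- the value of `t⋆`
      IntegrableOn (fun w : ℝ => 1 / (w * √(w - 1))) (Set.Ioi 1) ∧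
      Complex.I / 2 * ((∫ w in Set.Ioi (1 : ℝ), 1 / (w * √(w - 1)) : ℝ) : ℂ)
        = Complex.I * Real.pi / 2 ∧
      -- `t⋆` is a singularity of the particles with `ψ = 0`, `w(0) = 1`
      (∀ a, abStream a = 0 → Real.sin (a 0) ^ 2 = 1 →
        IsComplexTimeSingularity (X a) (Complex.I * Real.pi / 2)) ∧
      -- and it is, with its complex conjugate, the nearest one among all particles
      (∀ a τ, IsComplexTimeSingularity (X a) τ → Real.pi / 2 ≤ ‖τ‖ ∧
        (‖τ‖ = Real.pi / 2 → τ = Complex.I * Real.pi / 2 ∨ τ = -(Complex.I * Real.pi / 2))) ∧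
      -- the time-Taylor series represents the Lagrangian map and has radius `π / 2`
      (∀ (a : E3) (t : ℝ), |t| < Real.pi / 2 →
        HasSum (fun s : ℕ => t ^ s • taylorCoeff X a s) (X a t - a)) ∧
      lagrangianRadius X = ENNReal.ofReal (Real.pi / 2) ∧
      (∃ a, (taylorSeries X a).radius = ENNReal.ofReal (Real.pi / 2)) ∧
      uniformLagrangianRadius X = ENNReal.ofReal (Real.pi / 2) := by
  refine ⟨isSteadyEuler_abFlow, curl_abFlow, existsUnique_isLagrangianMap_abFlow, fun X hX => ?_⟩
  have hx0 : ∀ a, X a 0 = a := fun a => (hX a).1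
  have hψ : ∀ a, Real.sin (X a 0 0) * Real.cos (X a 0 1) = abStream a := fun a => by
    rw [hx0 a, abStream]
  obtain ⟨a₀, ha₀, hs₀⟩ : ∃ a : E3, abStream a = 0 ∧ Real.sin (a 0) ^ 2 = 1 :=
    ⟨!₂[Real.pi / 2, Real.pi / 2, 0], by simp [abStream], by simp⟩
  refine ⟨fun a t => ?_, hX.abFlow_two_eq, fun a t => ?_, fun a ε t₀ t₁ ha hε ht hpos => ?_,
    fun a t ha => ⟨?_, ?_⟩, integral_one_div_mul_sqrt_sub_one.1, ?_,
    fun a h1 h2 => hX.isComplexTimeSingularity_half_pi h1 h2,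
    fun a τ hτ => hX.complexTimeSingularity_bound hτ,
    fun a t ht => hX.hasSum_taylorCoeff a ht,
    le_antisymm ?_ (le_iInf hX.half_pi_le_radius), ⟨a₀, hX.radius_eq_half_pi ha₀ hs₀⟩,
    hX.uniformLagrangianRadius_eq ha₀ hs₀⟩
  · rw [← hψ a]; exact (hX.planarAB a).sin_mul_cos_eq t
  · rw [← hψ a]; exact (hX.planarAB a).hasDerivAt_sin_sq_sign t
  · rw [← hψ a]
    exact (hX.planarAB a).elliptic_integral (by simpa [hx0 a] using ha) hε ht hpos
  · simpa [hx0 a] using (hX.planarAB a).fst_eq_of_sin_eq_zero (by simpa [hx0 a] using ha) t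
  · simpa [hx0 a] using (hX.planarAB a).sin_snd_eq (by simpa [hx0 a] using ha) t
  · rw [integral_one_div_mul_sqrt_sub_one.2]; ring
  · exact (iInf_le _ a₀).trans_eq (hX.radius_eq_half_pi ha₀ hs₀)
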